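/- An election $E=(C,V)$ consists of a finite set $C$ of candidates and a list $V=(v_1,\dots,v_n)$ of linear orders over $C$; write $a\succ_i b$ if $a$ precedes $b$ in $v_i$, and $[n]=\{1,\dots,n\}$. For $X\subseteq C$, let $E|_X$ denote the election with candidate set $X$ in which each vote is restricted to $X$. The election $E$ is single-crossing (with respect to the given order of voters) if for all candidates $a,b$ with $a\succ_1 b$ there is a $t\in[n]$ such that $\{i\in[n] : a\succ_i b\}=[t]$. A pair $\langle E,k\rangle$ of an election and a non-negative integer is a yes-instance of Candidate Deletion if there is a set $X\subseteq C$ with $|X|\ge |C|-k$ such that $E|_X$ is single-crossing. For fixed $k\ge 1$, an election $E$ is a yes-instance of $k$-Candidate Partition if $C$ can be partitioned into $k$ (possibly empty) sets $C_1,\dots,C_k$ such that $E|_{C_j}$ is single-crossing for each $j\in[k]$. Theorem. Given an election $E=(C,V)$ with at most three voters and a non-negative integer $k$, one can decide in polynomial time whether $\langle E,k\rangle$ is a yes-instance of Candidate Deletion. Moreover, for each fixed $k\ge 1$, given an election $E$ with at most three voters, one can decide in polynomial time whether $E$ is a yes-instance of $k$-Candidate Partition. Here polynomial time means time polynomial in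 the input length on a multi-tape Turing machine, where an election is given by listing its candidates and its votes (each as a ranking), with candidate names and the integer $k$ of Candidate Deletion written in binary. -/

import Mathlib

/-- An election over a set `C` of candidates: a list of votes, each vote a linear order on `C`.
In the order `vote i`, smaller means better: `a < b` says that voter `i` ranks `a` above `b`.
Voters are numbered `0, …, numVoters - 1`. -/
structure Election (C : Type) where
  numVoters : ℕ
  vote : Fin numVoters → LinearOrder C

namespace Election

/-- `E.Prefers i a b`: voter `i` prefers `a` to `b`. -/
def Prefers {C : Type} (E : Election C) (i : Fin E.numVoters) (a b : C) : Prop :=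
  (E.vote i).lt a b

/-- The restriction of an election to a subset `X` of the candidates. -/
def restrict {C : Type} (E : Election C) (X : Finset C) : Election X where
  numVoters := E.numVoters
  vote i := @LinearOrder.lift' X C (E.vote i) Subtype.val Subtype.val_injective

/-- Single-crossing with respect to the given order of the voters: if the first voter prefers
`a` to `b`, then the voters who prefer `a` to `b` are exactly the first `t` ones,
for some `1 ≤ t ≤ n`. (An election without voters satisfies this vacuously.) -/
def IsSingleCrossing {C : Type} (E : Election C) : Prop :=
  ∀ (h : 0 < E.numVoters) (a b : C), E.Prefers ⟨0, h⟩ a b →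
    ∃ t : ℕ, 1 ≤ t ∧ t ≤ E.numVoters ∧
      {i : Fin E.numVoters | E.Prefers i a b} = {i : Fin E.numVoters | (i : ℕ) < t}

/-- `⟨E, k⟩` is a yes-instance of Candidate Deletion. -/
def CandidateDeletion {C : Type} [Fintype C] (E : Election C) (k : ℕ) : Prop :=
  ∃ X : Finset C, (X.card : ℤ) ≥ (Fintype.card C : ℤ) - (k : ℤ) ∧
    (E.restrict X).IsSingleCrossing

/-- `E` is a yes-instance of `k`-Candidate Partition: the candidates split into `k` pairwise
disjoint (possibly empty) classes on each of which `E` is single-crossing. -/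
def CandidatePartition {C : Type} (k : ℕ) (E : Election C) : Prop :=
  ∃ P : Fin k → Finset C, (∀ a : C, ∃! j : Fin k, a ∈ P j) ∧
    ∀ j : Fin k, (E.restrict (P j)).IsSingleCrossing

/-- The vote of voter `i`, written out as a list of candidates, best candidate first. -/
def ranking {C : Type} [Fintype C] (E : Election C) (i : Fin E.numVoters) : List C :=
  letI : LinearOrder C := E.vote i
  Finset.univ.sort (fun a b : C => a ≤ b)

end Election

/-- A list of natural numbers as a string: the numbers in binary, each followed by a comma,
between an opening and a closing bracket. -/
def encodeNatList (l : List ℕ) : List Computability.Γ' :=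
  Computability.Γ'.bra ::
    (l.flatMap (fun a => Computability.encodingNatΓ'.encode a ++ [Computability.Γ'.comma]) ++
      [Computability.Γ'.ket])

/-- An election given as input, with candidates named `0, …, m - 1`. -/
abbrev ElectionInput : Type := Σ m : ℕ, Election (Fin m)

/-- The string representing an election: the list of its candidates, followed by the votes in
order, each one as a list of candidates from best to worst. -/
def encodeElection (E : ElectionInput) : List Computability.Γ' :=
  encodeNatList ((List.finRange E.1).map Fin.val) ++
    (List.finRange E.2.numVoters).flatMap
      (fun i => encodeNatList ((E.2.ranking i).map Fin.val))

/-- The string representing a pair `⟨E, k⟩`: the integer `k` in binary, a comma, and `E`. -/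
def encodeElectionNat (I : ElectionInput × ℕ) : List Computability.Γ' :=
  Computability.encodingNatΓ'.encode I.2 ++ Computability.Γ'.comma :: encodeElection I.1

open Classical in
/-- The property `P` of instances from `α`, presented as strings by `enc`, is decided by a
(multi-stack) Turing machine that outputs the correct truth value on every instance, within a
number of steps that is polynomial in the length of the string. -/
def DecidableInPolyTime {α Γ : Type} (enc : α → List Γ) (P : α → Prop) : Prop :=
  Nonempty (Turing.TM2ComputableInPolyTime enc Computability.encodeBool
    (fun a => decide (P a)))

/-! ## A structured programming language for stack machines -/

namespace StackProg

open Computability Turing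

/-! Mathematics. With at most two voters every election is single-crossing. With three voters, the
only voter set that contains the first voter and is not an initial segment consists of the first and
the third. So a restriction is single-crossing iff it contains no pair `a`, `b` with `a` above `b`
in votes 1 and 3 and below it in vote 2 (`isSingleCrossing_three_iff`). This relation `conflict` is
the intersection of vote 1, vote 3 and the reverse of vote 2, hence a strict partial order, and
single-crossing restrictions are exactly its antichains. Candidate Deletion asks for a largest
antichain and `k`-Candidate Partition for a partition into `k` antichains.

By Dilworth's theorem in its matching form, a largest antichain has `n - μ` elements, where `μ` is
the size of a maximum matching in the bipartite graph with two copies of the candidates as sides and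
the order as edges. The matching is found by an auction in which the price of an item is the number
of owners it has had. The final owners form a matching, which bounds all antichains
(`card_antichain_add_le`); the final prices give a vertex cover of the same size, whose complement
is an antichain (`exists_antichain`). Both are combined in `matchNumber_spec`. A partition into `k`
antichains exists iff `k` removals of the minimal elements leave nothing, as in Mirsky's theorem
(`strip_iterate_eq_nil_iff`).

Complexity. Structured programs on four stacks are compiled into multi-stack machines
(`Exec.stepsTo`). Data are binary trees written in prefix order, and `PolyTime` is the class of
functions for which a program replaces the topmost tree in polynomial time. It is closed under
composition, pairing, case distinction, loops whose states stay polynomially bounded, and folds that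
add a polynomial amount per element. The algorithms are built from these operations, and
`decidableInPolyTime_of_polyTime` turns the result into a machine. -/

/-- The four stacks on which programs work. -/
inductive Stk
  | a | b | c | d
  deriving DecidableEq

instance : Fintype Stk := ⟨{.a, .b, .c, .d}, fun k => by cases k <;> simp⟩

/-- The content of the register. -/
abbrev Reg : Type := Option Γ'

/-- The contents of the four stacks. -/
abbrev Stacks : Type := Stk → List Γ'

/-- Programs: `push k f` pushes a symbol computed from the register, `pop k` moves the top symbol
of a stack to the register, `case` branches on the register, and `loop p q` repeats `q` while the
register satisfies `p`. -/
inductive Prog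
  | push (k : Stk) (f : Reg → Γ')
  | pop (k : Stk)
  | peek (k : Stk)
  | seq (p q : Prog)
  | case (f : Reg → Prog)
  | loop (p : Reg → Bool) (q : Prog)

/-- `Exec p v S t v' S'`: started with register `v` and stacks `S`, the program `p` stops after `t`
steps with register `v'` and stacks `S'`. -/
inductive Exec : Prog → Reg → Stacks → ℕ → Reg → Stacks → Prop
  | push (k f v S) : Exec (.push k f) v S 1 v (Function.update S k (f v :: S k))
  | pop (k v S) : Exec (.pop k) v S 1 (S k).head? (Function.update S k (S k).tail)
  | peek (k v S) : Exec (.peek k) v S 1 (S k).head? S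
  | seq {p q v S t v' S' t' v'' S''} (h : Exec p v S t v' S') (h' : Exec q v' S' t' v'' S'') :
      Exec (.seq p q) v S (t + t') v'' S''
  | case {f v S t v' S'} (h : Exec (f v) v S t v' S') : Exec (.case f) v S (t + 1) v' S'
  | loop_exit {p q v} (S) (hv : p v = false) : Exec (.loop p q) v S 1 v S
  | loop_step {p q v S t v' S' t' v'' S''} (hv : p v = true) (h : Exec q v S t v' S')
      (h' : Exec (.loop p q) v' S' t' v'' S'') : Exec (.loop p q) v S (t + t' + 1) v'' S''

/-! ### Compilation of programs into multi-stack machines. -/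

/-- The labels of the machine for a program. -/
def Lbl : Prog → Type
  | .push _ _ => Unit
  | .pop _ => Unit
  | .peek _ => Unit
  | .seq p q => Lbl p ⊕ Lbl q
  | .case f => Option (Σ v, Lbl (f v))
  | .loop _ q => Option (Lbl q)

noncomputable instance Lbl.fintype : ∀ p : Prog, Fintype (Lbl p)
  | .push _ _ => inferInstanceAs (Fintype Unit)
  | .pop _ => inferInstanceAs (Fintype Unit)
  | .peek _ => inferInstanceAs (Fintype Unit)
  | .seq p q =>
    letI := Lbl.fintype p
    letI := Lbl.fintype q
    inferInstanceAs (Fintype (Lbl p ⊕ Lbl q))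
  | .case f =>
    letI := fun v => Lbl.fintype (f v)
    inferInstanceAs (Fintype (Option (Σ v, Lbl (f v))))
  | .loop _ q =>
    letI := Lbl.fintype q
    inferInstanceAs (Fintype (Option (Lbl q)))

/-- The label at which the machine for a program starts. -/
def entry : (p : Prog) → Lbl p
  | .push _ _ => ()
  | .pop _ => ()
  | .peek _ => ()
  | .seq p _ => Sum.inl (entry p)
  | .case _ => none
  | .loop _ _ => none

/-- The stack alphabets of a machine with an additional stack of truth values. -/
abbrev Alph : Option Stk → Type
  | none => Bool
  | some _ => Γ'

/-- The statements of the machine for a program, with labels renamed by `e` and with `x` as the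
label to which the machine jumps at the end. -/
def code {L : Type} : (p : Prog) → (Lbl p → L) → L → Lbl p → TM2.Stmt Alph L Reg
  | .push k f, _, x => fun _ => .push (some k) f (.goto fun _ => x)
  | .pop k, _, x => fun _ => .pop (some k) (fun _ o => o) (.goto fun _ => x)
  | .peek k, _, x => fun _ => .peek (some k) (fun _ o => o) (.goto fun _ => x)
  | .seq p q, e, x => fun l =>
    match l with
    | .inl l => code p (fun l => e (.inl l)) (e (.inr (entry q))) l
    | .inr l => code q (fun l => e (.inr l)) x l
  | .case f, e, x => fun l =>
    match l with
    | none => .goto fun v => e (some ⟨v, entry (f v)⟩)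
    | some s => code (f s.1) (fun l => e (some ⟨s.1, l⟩)) x s.2
  | .loop p q, e, x => fun l =>
    match l with
    | none => .goto fun v => if p v then e (some (entry q)) else x
    | some l => code q (fun l => e (some l)) (e none) l

/-- The stacks of the machine, from the output stack and the stacks of a program. -/
def lift (o : List Bool) (S : Stacks) : (k : Option Stk) → List (Alph k)
  | none => o
  | some k => S k

theorem update_lift (o : List Bool) (S : Stacks) (k : Stk) (l : List Γ') :
    Function.update (lift o S) (some k) l = lift o (Function.update S k l) := by
  funext k'
  cases k' with
  | none => rfl
  | some k' =>
    by_cases h : k' = k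
    · subst h
      simp [lift]
    · have h' : some k' ≠ some k := by simpa using h
      simp [lift, Function.update_of_ne h, Function.update_of_ne h']

/-- The machine `M` goes from configuration `a` to configuration `b` in `t` steps. -/
def StepsTo {L : Type} (M : L → TM2.Stmt Alph L Reg) (t : ℕ) (a b : TM2.Cfg Alph L Reg) : Prop :=
  (flip bind (TM2.step M))^[t] (some a) = some b

theorem StepsTo.trans {L : Type} {M : L → TM2.Stmt Alph L Reg} {t t' : ℕ}
    {a b c : TM2.Cfg Alph L Reg} (h : StepsTo M t a b) (h' : StepsTo M t' b c) :
    StepsTo M (t + t') a c := by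
  unfold StepsTo at *
  rw [add_comm, Function.iterate_add_apply, h, h']

theorem stepsTo_one {L : Type} {M : L → TM2.Stmt Alph L Reg} {l : L} {v : Reg}
    {S : (k : Option Stk) → List (Alph k)} {b : TM2.Cfg Alph L Reg}
    (h : TM2.stepAux (M l) v S = b) : StepsTo M 1 ⟨some l, v, S⟩ b := by
  subst h
  rfl

/-- The machine `M` is arbitrary: it only has to carry the code of `p` at the labels renamed by `e`.
Hence the induction hypotheses apply to subprograms, which are parts of the same larger machine. -/
theorem Exec.stepsTo {L : Type} {M : L → TM2.Stmt Alph L Reg} {p : Prog} {v : Reg} {S : Stacks}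
    {t : ℕ} {v' : Reg} {S' : Stacks} (h : Exec p v S t v' S') (o : List Bool) :
    ∀ (e : Lbl p → L) (x : L), (∀ l, M (e l) = code p e x l) →
      StepsTo M t ⟨some (e (entry p)), v, lift o S⟩ ⟨some x, v', lift o S'⟩ := by
  induction h with
  | push k f v S =>
    intro e x hM
    refine stepsTo_one ?_
    rw [hM]
    simp only [code, TM2.stepAux]
    rw [← update_lift]
    rfl
  | pop k v S =>
    intro e x hM
    refine stepsTo_one ?_
    rw [hM]
    simp only [code, TM2.stepAux]
    rw [← update_lift]
    rfl
  | peek k v S =>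
    intro e x hM
    refine stepsTo_one ?_
    rw [hM]
    rfl
  | seq _ _ ih ih' =>
    intro e x hM
    exact (ih _ _ fun l => hM (.inl l)).trans (ih' _ _ fun l => hM (.inr l))
  | case _ ih =>
    intro e x hM
    rw [add_comm]
    refine StepsTo.trans (stepsTo_one ?_) (ih (fun l => e (some ⟨_, l⟩)) x fun l => ?_)
    · rw [hM, entry, code]
      rfl
    · exact (hM (some ⟨_, l⟩)).trans (by rw [code])
  | loop_exit S hv =>
    intro e x hM
    refine stepsTo_one ?_
    rw [hM]
    simp [code, entry, TM2.stepAux, hv]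
  | loop_step hv _ _ ih ih' =>
    intro e x hM
    rw [add_comm]
    refine StepsTo.trans (stepsTo_one ?_) (StepsTo.trans (ih _ _ fun l => hM (some l)) (ih' e x hM))
    rw [hM]
    simp [code, entry, TM2.stepAux, hv]

/-- The machine for a program that finally moves its answer from the register to the output
stack. -/
noncomputable def machine (p : Prog) : FinTM2 where
  K := Option Stk
  k₀ := some .b
  k₁ := none
  Γ := Alph
  Λ := Option (Lbl p)
  main := some (entry p)
  σ := Reg
  initialState := none
  Γk₀Fin := inferInstanceAs (Fintype Γ')
  m l := match l with
    | some l => code p some none l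
    -- The configuration `haltList` has the register in its initial state, hence the reset.
    | none => .push none (fun v => decide (v = some (.bit true))) (.load (fun _ => none) .halt)

/-- A stack machine decides a property in polynomial time if a program computes the answer. -/
theorem decidableInPolyTime_of_exec {α : Type} {enc : α → List Γ'} {P : α → Prop} (p : Prog)
    (T : Polynomial ℕ)
    (h : ∀ x, ∃ t ≤ T.eval (enc x).length, ∃ v', (v' = some (.bit true) ↔ P x) ∧
      Exec p none (Function.update (fun _ => []) .b (enc x)) t v' (fun _ => [])) :
    DecidableInPolyTime enc P := by
  classical
  choose t ht v' hv' hexec using h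
  refine ⟨{ tm := machine p, inputAlphabet := Equiv.refl _, outputAlphabet := Equiv.refl _,
            time := T + 1, outputsFun := fun x => ⟨⟨t x + 1, ?_⟩, ?_⟩ }⟩
  · have h₁ := (hexec x).stepsTo (M := (machine p).m) [] some none (fun l => rfl)
    have h₂ := h₁.trans (stepsTo_one (b := haltList (machine p) [decide (P x)]) ?_)
    · have h₃ : initList (machine p) (enc x) = ⟨some (some (entry p)), none,
          lift [] (Function.update (fun _ => []) Stk.b (enc x))⟩ := by
        simp only [initList]
        congr 1
        funext k
        rcases k with _ | _ | _ | _ | _ <;> rfl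
      have h₄ : StepsTo (machine p).m (t x + 1) (initList (machine p) (enc x))
          (haltList (machine p) [decide (P x)]) := by
        rw [h₃]
        exact h₂
      have h₅ : List.map (Equiv.refl ((machine p).Γ (machine p).k₀)).invFun (enc x) = enc x :=
        List.map_id _
      exact (congrArg (fun l => (flip bind (machine p).step)^[t x + 1]
        (some (initList (machine p) l))) h₅).trans h₄
    · simp only [machine, TM2.stepAux, haltList]
      congr 1
      funext k
      rcases k with _ | _
      · simp only [Function.update_self, lift, hv']
        rfl
      · rfl
  · simpa using ht x

/-! ## Bounded execution and stack operations -/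

/-- The stack contents with the given contents of the single stacks. -/
def stk (a b c d : List Γ') : Stacks
  | .a => a
  | .b => b
  | .c => c
  | .d => d

section Stk

variable (a b c d l : List Γ')

@[simp] theorem stacks_a : stk a b c d .a = a := rfl
@[simp] theorem stacks_b : stk a b c d .b = b := rfl
@[simp] theorem stacks_c : stk a b c d .c = c := rfl
@[simp] theorem stacks_d : stk a b c d .d = d := rfl

@[simp] theorem update_stacks_a : Function.update (stk a b c d) .a l = stk l b c d := by
  funext k; cases k <;> rfl
@[simp] theorem update_stacks_b : Function.update (stk a b c d) .b l = stk a l c d := by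
  funext k; cases k <;> rfl
@[simp] theorem update_stacks_c : Function.update (stk a b c d) .c l = stk a b l d := by
  funext k; cases k <;> rfl
@[simp] theorem update_stacks_d : Function.update (stk a b c d) .d l = stk a b c l := by
  funext k; cases k <;> rfl

end Stk

theorem Exec.of_time_eq {p : Prog} {v v' : Reg} {S S' : Stacks} {t t' : ℕ}
    (h : Exec p v S t v' S') (ht : t = t') : Exec p v S t' v' S' :=
  ht ▸ h

/-- Started with stacks `S` and any register, `p` stops with stacks `S'` after at most `T` steps. -/
def Run (p : Prog) (S : Stacks) (T : ℕ) (S' : Stacks) : Prop :=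
  ∀ v, ∃ v' t, t ≤ T ∧ Exec p v S t v' S'

theorem Run.seq {p q : Prog} {S S' S'' : Stacks} {T T' : ℕ} (h : Run p S T S')
    (h' : Run q S' T' S'') : Run (.seq p q) S (T + T') S'' := by
  intro v
  obtain ⟨v', t, ht, e⟩ := h v
  obtain ⟨v'', t', ht', e'⟩ := h' v'
  exact ⟨v'', t + t', by omega, e.seq e'⟩

theorem Run.mono {p : Prog} {S S' : Stacks} {T T' : ℕ} (h : Run p S T S') (hT : T ≤ T') :
    Run p S T' S' := by
  intro v
  obtain ⟨v', t, ht, e⟩ := h v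
  exact ⟨v', t, by omega, e⟩

theorem run_push (k : Stk) (s : Γ') (S : Stacks) :
    Run (.push k fun _ => s) S 1 (Function.update S k (s :: S k)) :=
  fun v => ⟨v, 1, le_rfl, .push k _ v S⟩

/-- Pop a symbol and branch on it. -/
def popCase (k : Stk) (f : Reg → Prog) : Prog := .seq (.pop k) (.case f)

theorem run_popCase {k : Stk} {f : Reg → Prog} {S S' : Stacks} {T : ℕ}
    (h : Run (f (S k).head?) (Function.update S k (S k).tail) T S') :
    Run (popCase k f) S (T + 2) S' := by
  intro v
  obtain ⟨v', t, ht, e⟩ := h (S k).head?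
  exact ⟨v', 1 + (t + 1), by omega, .seq (.pop k v S) (.case e)⟩

/-- Move the whole content of stack `k` to stack `k'`, which reverses it. -/
def flush (k k' : Stk) : Prog :=
  .seq (.pop k) (.loop Option.isSome (.seq (.push k' fun v => v.getD .blank) (.pop k)))

/-- Popping an empty stack puts `none` into the register, which ends the loop. Each symbol costs a
test, a push and a pop. -/
theorem run_flush_aux {k k' : Stk} (hk : k ≠ k') (S : Stacks) (l l' : List Γ') (v : Reg) :
    Exec (flush k k') v (Function.update (Function.update S k l) k' l') (3 * l.length + 2) none
      (Function.update (Function.update S k []) k' (l.reverse ++ l')) := by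
  have hpop : ∀ (v : Reg) (l l' : List Γ'), Exec (.pop k) v
      (Function.update (Function.update S k l) k' l') 1 l.head?
      (Function.update (Function.update S k l.tail) k' l') := by
    intro v l l'
    have := Exec.pop k v (Function.update (Function.update S k l) k' l')
    rwa [Function.update_of_ne hk, Function.update_self,
      Function.update_comm hk l l' S, Function.update_idem,
      show Function.update (Function.update S k' l') k l.tail =
        Function.update (Function.update S k l.tail) k' l' from
        Function.update_comm hk.symm .., Function.update_comm hk.symm] at this
  have hloop : ∀ (l l' : List Γ'),
      Exec (.loop Option.isSome (.seq (.push k' fun v => v.getD .blank) (.pop k))) l.head?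
        (Function.update (Function.update S k l.tail) k' l') (3 * l.length + 1) none
        (Function.update (Function.update S k []) k' (l.reverse ++ l')) := by
    intro l
    induction l with
    | nil => exact fun l' => .loop_exit _ rfl
    | cons s l ih =>
      intro l'
      have h₁ := Exec.push k' (fun v => v.getD .blank) (some s)
        (Function.update (Function.update S k l) k' l')
      rw [Function.update_self, Function.update_idem] at h₁
      have h₂ := Exec.loop_step (p := Option.isSome) rfl (h₁.seq (hpop _ l (s :: l'))) (ih (s :: l'))
      simp only [List.length_cons, List.reverse_cons, List.append_assoc, List.singleton_append,
        List.head?_cons, List.tail_cons] at h₂ ⊢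
      convert h₂ using 1
      ring
  exact ((hpop v l l').seq (hloop l l')).of_time_eq (by omega)

theorem run_flush {k k' : Stk} (hk : k ≠ k') (S : Stacks) :
    Run (flush k k') S (3 * (S k).length + 2)
      (Function.update (Function.update S k []) k' ((S k).reverse ++ S k')) := by
  intro v
  have := run_flush_aux hk S (S k) (S k') v
  rw [Function.update_eq_self, Function.update_eq_self] at this
  exact ⟨_, _, le_rfl, this⟩

/-- Move the whole content of stack `b` to both `a` and `c`. -/
def fork : Prog :=
  .seq (.pop .b) (.loop Option.isSome (.seq (.push .a fun v => v.getD .blank)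
    (.seq (.push .c fun v => v.getD .blank) (.pop .b))))

theorem run_fork (a b c d : List Γ') :
    Run fork (stk a b c d) (4 * b.length + 2)
      (stk (b.reverse ++ a) [] (b.reverse ++ c) d) := by
  have hpop : ∀ (v : Reg) (a b c : List Γ'), Exec (.pop .b) v (stk a b c d) 1 b.head?
      (stk a b.tail c d) := fun v a b c => by
    simpa using Exec.pop .b v (stk a b c d)
  have hloop : ∀ (b a c : List Γ'),
      Exec (.loop Option.isSome (.seq (.push .a fun v => v.getD .blank)
        (.seq (.push .c fun v => v.getD .blank) (.pop .b)))) b.head?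
        (stk a b.tail c d) (4 * b.length + 1) none
        (stk (b.reverse ++ a) [] (b.reverse ++ c) d) := by
    intro b
    induction b with
    | nil => exact fun a c => .loop_exit _ rfl
    | cons s b ih =>
      intro a c
      have h₁ := Exec.push .a (fun v => v.getD .blank) (some s) (stk a b c d)
      have h₂ := Exec.push .c (fun v => v.getD .blank) (some s) (stk (s :: a) b c d)
      simp only [update_stacks_a, update_stacks_c, stacks_a, stacks_c, Option.getD_some] at h₁ h₂
      have h₃ := Exec.loop_step (p := Option.isSome) rfl (h₁.seq (h₂.seq (hpop _ _ b _)))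
        (ih (s :: a) (s :: c))
      simp only [List.length_cons, List.reverse_cons, List.append_assoc, List.singleton_append,
        List.head?_cons, List.tail_cons] at h₃ ⊢
      convert h₃ using 1
      ring
  intro v
  exact ⟨_, _, by omega, (hpop v a b c).seq (hloop b a c)⟩

/-- Empty the stack `b`. -/
def clear : Prog := .seq (.pop .b) (.loop Option.isSome (.pop .b))

theorem run_clear (a b c d : List Γ') :
    Run clear (stk a b c d) (2 * b.length + 2) (stk a [] c d) := by
  have hpop : ∀ (v : Reg) (b : List Γ'), Exec (.pop .b) v (stk a b c d) 1 b.head?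
      (stk a b.tail c d) := fun v b => by
    simpa using Exec.pop .b v (stk a b c d)
  have hloop : ∀ b : List Γ', Exec (.loop Option.isSome (.pop .b)) b.head?
        (stk a b.tail c d) (2 * b.length + 1) none (stk a [] c d) := by
    intro b
    induction b with
    | nil => exact .loop_exit _ rfl
    | cons s b ih =>
      have h₃ := Exec.loop_step (p := Option.isSome) rfl (hpop (some s) b) ih
      simp only [List.length_cons, List.head?_cons, List.tail_cons] at h₃ ⊢
      convert h₃ using 1
      ring
  intro v
  exact ⟨_, _, by omega, (hpop v b).seq (hloop b)⟩

/-- Push a list of symbols on the stack `a`. -/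
def write : List Γ' → Prog
  | [] => .peek .a
  | s :: l => .seq (write l) (.push .a fun _ => s)

theorem run_write (l a b c d : List Γ') :
    Run (write l) (stk a b c d) (l.length + 1) (stk (l ++ a) b c d) := by
  induction l with
  | nil => exact fun v => ⟨_, _, le_rfl, .peek .a v _⟩
  | cons s l ih =>
    have := ih.seq (run_push .a s _)
    simp only [stacks_a, update_stacks_a] at this
    exact this

/-! ## Trees on the stack -/

/-- Binary trees, the data on which polynomial-time functions work. -/
inductive Tr
  | leaf
  | node (x y : Tr)

/-- The string for a tree: its nodes and leaves in prefix order. -/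
def Tr.str : Tr → List Γ'
  | .leaf => [.bit false]
  | .node x y => .bit true :: (x.str ++ y.str)

/-- The length of the string for a tree. -/
def Tr.size (x : Tr) : ℕ := x.str.length

@[simp] theorem Tr.size_leaf : Tr.leaf.size = 1 := rfl
@[simp] theorem Tr.size_node (x y : Tr) : (Tr.node x y).size = x.size + y.size + 1 := by
  simp [Tr.size, Tr.str]
theorem Tr.length_str (x : Tr) : x.str.length = x.size := rfl

/-- One step of moving a tree from `a` to `b`; the height of the stack `d` is the number of
pending subtrees. -/
def moveStep : Prog :=
  .seq (.pop .a) (.seq (.push .b fun v => v.getD .blank)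
    (.seq (.case fun v => if v = some (.bit true) then .push .d fun _ => .blank else .pop .d)
      (.peek .d)))

/-- Prefix strings delimit themselves: a node symbol replaces one pending subtree by two, a leaf
symbol completes one. The statement takes the rest of the run as a hypothesis, so that for a node
the induction hypotheses of the two subtrees can be chained. The register holds the top of `d` at
every test. -/
theorem exec_move_loop (x : Tr) : ∀ (r b c d : List Γ') (s : Γ') (t : ℕ) (v' : Reg) (S' : Stacks),
    Exec (.loop Option.isSome moveStep) d.head? (stk r (x.str.reverse ++ b) c d) t v' S' →
    Exec (.loop Option.isSome moveStep) (some s) (stk (x.str ++ r) b c (s :: d))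
      (6 * x.size + t) v' S' := by
  induction x with
  | leaf =>
    intro r b c d s t v' S' h
    have h₁ := Exec.pop .a (some s) (stk (.bit false :: r) b c (s :: d))
    have h₂ := Exec.push .b (fun v => v.getD .blank) (some (.bit false)) (stk r b c (s :: d))
    have h₃ := Exec.pop .d (some (.bit false)) (stk r (.bit false :: b) c (s :: d))
    have h₄ := Exec.peek .d (some s) (stk r (.bit false :: b) c d)
    simp only [stacks_a, stacks_b, stacks_d, update_stacks_a, update_stacks_b, update_stacks_d,
      List.head?_cons, List.tail_cons, Option.getD_some] at h₁ h₂ h₃ h₄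
    have h₅ : Exec (.case fun v => if v = some (.bit true) then .push .d fun _ => .blank
        else .pop .d) (some (.bit false)) _ (1 + 1) _ _ := .case (by
      simpa only [reduceCtorEq, Option.some.injEq, Γ'.bit.injEq, Bool.false_eq_true, if_true,
        if_false] using h₃)
    have h₆ := Exec.loop_step (p := Option.isSome) rfl (h₁.seq (h₂.seq (h₅.seq h₄))) h
    exact h₆.of_time_eq (by simp; omega)
  | node x y ihx ihy =>
    intro r b c d s t v' S' h
    have h₁ := Exec.pop .a (some s) (stk (.bit true :: (x.str ++ y.str ++ r)) b c (s :: d))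
    have h₂ := Exec.push .b (fun v => v.getD .blank) (some (.bit true))
      (stk (x.str ++ y.str ++ r) b c (s :: d))
    have h₃ := Exec.push .d (fun _ => .blank) (some (.bit true))
      (stk (x.str ++ y.str ++ r) (.bit true :: b) c (s :: d))
    have h₄ := Exec.peek .d (some (.bit true))
      (stk (x.str ++ y.str ++ r) (.bit true :: b) c (.blank :: s :: d))
    simp only [stacks_a, stacks_b, stacks_d, update_stacks_a, update_stacks_b, update_stacks_d,
      List.head?_cons, List.tail_cons, Option.getD_some] at h₁ h₂ h₃ h₄
    have h₅ : Exec (.case fun v => if v = some (.bit true) then .push .d fun _ => .blank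
        else .pop .d) (some (.bit true)) _ (1 + 1) _ _ := .case (by
      simpa only [reduceCtorEq, Option.some.injEq, Γ'.bit.injEq, Bool.false_eq_true, if_true,
        if_false] using h₃)
    have h₇ := ihx (y.str ++ r) (.bit true :: b) c (s :: d) .blank _ _ _
      (ihy r (x.str.reverse ++ .bit true :: b) c d s t v' S' (by simpa [Tr.str] using h))
    rw [← List.append_assoc] at h₇
    have h₆ := Exec.loop_step (p := Option.isSome) rfl (h₁.seq (h₂.seq (h₅.seq h₄))) h₇
    exact h₆.of_time_eq (by simp; omega)

/-- Move a tree from `a` to `b`, which reverses its string. -/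
def move : Prog :=
  .seq (.push .d fun _ => .blank) (.seq (.peek .d) (.loop Option.isSome moveStep))

theorem run_move (x : Tr) (r b c : List Γ') :
    Run move (stk (x.str ++ r) b c []) (6 * x.size + 3)
      (stk r (x.str.reverse ++ b) c []) := by
  intro v
  have h₁ := Exec.push .d (fun _ => .blank) v (stk (x.str ++ r) b c [])
  have h₂ := Exec.peek .d v (stk (x.str ++ r) b c [.blank])
  simp only [update_stacks_d, stacks_d, List.head?_cons] at h₁ h₂
  exact ⟨_, _, by omega,
    h₁.seq (h₂.seq (exec_move_loop x r b c [] .blank 1 none _ (.loop_exit _ rfl)))⟩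

/-- Remove a tree from the stack. -/
def drop : Prog := .seq move clear

theorem run_drop (x : Tr) (r : List Γ') :
    Run drop (stk (x.str ++ r) [] [] []) (8 * x.size + 5) (stk r [] [] []) := by
  have := (run_move x r [] []).seq (run_clear _ _ _ _)
  refine this.mono ?_
  simp [Tr.length_str]
  omega

/-- Duplicate the tree on the top of the stack. -/
def dup : Prog := .seq move (.seq fork (.seq (flush .c .b) (flush .b .a)))

theorem run_dup (x : Tr) (r : List Γ') :
    Run dup (stk (x.str ++ r) [] [] []) (16 * x.size + 9)
      (stk (x.str ++ (x.str ++ r)) [] [] []) := by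
  have h₁ := run_move x r [] []
  have h₂ := run_fork r (x.str.reverse ++ []) [] []
  have h₃ := run_flush (k := .c) (k' := .b) (by decide) (stk (x.str ++ r) [] x.str [])
  have h₄ := run_flush (k := .b) (k' := .a) (by decide) (stk (x.str ++ r) x.str.reverse [] [])
  simp only [update_stacks_a, update_stacks_b, update_stacks_c, stacks_a, stacks_b, stacks_c,
    List.append_nil, List.reverse_reverse, List.length_reverse, Tr.length_str] at h₁ h₂ h₃ h₄
  exact (h₁.seq (h₂.seq (h₃.seq h₄))).mono (by omega)

/-- Exchange the two topmost trees. -/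
def swap : Prog :=
  .seq move (.seq (flush .b .c) (.seq move (.seq (flush .c .d) (.seq (flush .d .a)
    (flush .b .a)))))

/-- Every flush reverses. The string of `x` stands upright in `c` and therefore returns to `a` by
way of `d`; that of `y` stands reversed in `b` and returns directly. -/
theorem run_swap (x y : Tr) (r : List Γ') :
    Run swap (stk (x.str ++ (y.str ++ r)) [] [] []) (15 * x.size + 15 * y.size + 20)
      (stk (y.str ++ (x.str ++ r)) [] [] []) := by
  have h₁ := run_move x (y.str ++ r) [] []
  have h₂ := run_flush (k := .b) (k' := .c) (by decide)
    (stk (y.str ++ r) x.str.reverse [] [])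
  have h₃ := run_move y r [] x.str
  have h₄ := run_flush (k := .c) (k' := .d) (by decide) (stk r y.str.reverse x.str [])
  have h₅ := run_flush (k := .d) (k' := .a) (by decide) (stk r y.str.reverse [] x.str.reverse)
  have h₆ := run_flush (k := .b) (k' := .a) (by decide) (stk (x.str ++ r) y.str.reverse [] [])
  simp only [update_stacks_a, update_stacks_b, update_stacks_c, update_stacks_d, stacks_a,
    stacks_b, stacks_c, stacks_d, List.append_nil, List.reverse_reverse, List.length_reverse,
    Tr.length_str] at h₁ h₂ h₃ h₄ h₅ h₆
  exact (h₁.seq (h₂.seq (h₃.seq (h₄.seq (h₅.seq h₆))))).mono (by omega)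

/-! ## Polynomial-time functions -/

/-- Types whose elements are represented by trees. -/
class Code (α : Type) where
  /-- The tree for an element. -/
  tr : α → Tr

/-- The size of the tree for an element. -/
def size {α : Type} [Code α] (x : α) : ℕ := (Code.tr x).size

/-- The string for an element. -/
abbrev str {α : Type} [Code α] (x : α) : List Γ' := (Code.tr x).str

instance : Code Tr := ⟨id⟩

instance : Code Unit := ⟨fun _ => .leaf⟩

instance : Code Bool := ⟨fun b => bif b then .node .leaf .leaf else .leaf⟩

instance {α β : Type} [Code α] [Code β] : Code (α × β) :=
  ⟨fun x => .node (Code.tr x.1) (Code.tr x.2)⟩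

/-- The tree for a list. -/
def listTr {α : Type} [Code α] : List α → Tr
  | [] => .leaf
  | a :: l => .node (Code.tr a) (listTr l)

instance {α : Type} [Code α] : Code (List α) := ⟨listTr⟩

/-- The tree for a natural number, in unary. -/
def natTr : ℕ → Tr
  | 0 => .leaf
  | n + 1 => .node .leaf (natTr n)

instance : Code ℕ := ⟨natTr⟩

section size

variable {α β : Type} [Code α] [Code β]

@[simp] theorem size_true : size true = 3 := rfl
@[simp] theorem size_false : size false = 1 := rfl
@[simp] theorem size_prod (x : α × β) : size x = size x.1 + size x.2 + 1 := Tr.size_node _ _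
@[simp] theorem size_nil : size ([] : List α) = 1 := rfl
@[simp] theorem size_cons (a : α) (l : List α) : size (a :: l) = size a + size l + 1 :=
  Tr.size_node _ _
@[simp] theorem size_nat (n : ℕ) : size n = 2 * n + 1 := by
  induction n with
  | zero => rfl
  | succ n ih =>
    have : size (n + 1) = 1 + size n + 1 := Tr.size_node _ _
    omega

theorem size_bool_le (b : Bool) : size b ≤ 3 := by cases b <;> simp

theorem size_list (l : List α) : size l = (l.map fun a => size a + 1).sum + 1 := by
  induction l with
  | nil => rfl
  | cons a l ih => simp [ih]; omega

theorem size_le_of_mem {a : α} {l : List α} (h : a ∈ l) : size a ≤ size l := by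
  rw [size_list]
  have := List.single_le_sum (l := l.map fun a => size a + 1) (by simp) _
    (List.mem_map_of_mem h)
  omega

theorem length_le_size (l : List α) : l.length ≤ size l := by
  induction l with
  | nil => simp
  | cons a l ih => simp; omega

theorem size_le_mul (l : List α) (N : ℕ) (h : ∀ a ∈ l, size a ≤ N) :
    size l ≤ l.length * (N + 1) + 1 := by
  induction l with
  | nil => simp
  | cons a l ih =>
    have h₁ := h a (by simp)
    have h₂ := ih fun b hb => h b (by simp [hb])
    simp only [size_cons, List.length_cons, Nat.add_mul]
    omega

end size

/-- Functions into the natural numbers that are bounded by a polynomial in the size. -/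
def PolyBdd {α : Type} [Code α] (g : α → ℕ) : Prop :=
  ∃ p : Polynomial ℕ, ∀ a, g a ≤ p.eval (size a)

theorem eval_mono (p : Polynomial ℕ) {m n : ℕ} (h : m ≤ n) : p.eval m ≤ p.eval n := by
  simp only [Polynomial.eval_eq_sum, Polynomial.sum]
  gcongr

namespace PolyBdd

variable {α β : Type} [Code α] [Code β] {g h : α → ℕ}

theorem of_le (hh : PolyBdd h) (hg : ∀ a, g a ≤ h a) : PolyBdd g := by
  obtain ⟨p, hp⟩ := hh
  exact ⟨p, fun a => (hg a).trans (hp a)⟩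

theorem const (n : ℕ) : PolyBdd fun _ : α => n := ⟨.C n, by simp⟩

theorem size : PolyBdd (size : α → ℕ) := ⟨.X, by simp⟩

theorem add (hg : PolyBdd g) (hh : PolyBdd h) : PolyBdd fun a => g a + h a := by
  obtain ⟨p, hp⟩ := hg
  obtain ⟨q, hq⟩ := hh
  exact ⟨p + q, fun a => by simpa using Nat.add_le_add (hp a) (hq a)⟩

theorem mul (hg : PolyBdd g) (hh : PolyBdd h) : PolyBdd fun a => g a * h a := by
  obtain ⟨p, hp⟩ := hg
  obtain ⟨q, hq⟩ := hh
  exact ⟨p * q, fun a => by simpa using Nat.mul_le_mul (hp a) (hq a)⟩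

theorem eval (p : Polynomial ℕ) (hg : PolyBdd g) : PolyBdd fun a => p.eval (g a) := by
  obtain ⟨q, hq⟩ := hg
  exact ⟨p.comp q, fun a => by simpa using eval_mono p (hq a)⟩

theorem comp {g : β → ℕ} {f : α → β} (hg : PolyBdd g) (hf : PolyBdd fun a => StackProg.size (f a)) :
    PolyBdd fun a => g (f a) := by
  obtain ⟨p, hp⟩ := hg
  exact (eval p hf).of_le fun a => hp (f a)

end PolyBdd

/-- The functions that are computed in polynomial time by a program that replaces the topmost tree
on the stack. -/
@[fun_prop]
def PolyTime {α β : Type} [Code α] [Code β] (f : α → β) : Prop :=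
  PolyBdd (fun a => size (f a)) ∧ ∃ p : Prog, ∃ T : α → ℕ, PolyBdd T ∧
    ∀ a r, Run p (stk (str a ++ r) [] [] []) (T a) (stk (str (f a) ++ r) [] [] [])

namespace PolyTime

variable {α β γ δ : Type} [Code α] [Code β] [Code γ] [Code δ]

theorem size_bdd {f : α → β} (hf : PolyTime f) : PolyBdd fun a => size (f a) := hf.1

/-- Polynomial time only depends on the trees for the arguments and values. -/
theorem of_tr_eq {f : α → β} (hf : PolyTime f) {g : γ → δ}
    (h : ∀ c, ∃ a, Code.tr a = Code.tr c ∧ Code.tr (f a) = Code.tr (g c)) : PolyTime g := by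
  obtain ⟨⟨q, hq⟩, p, T, ⟨t, hT⟩, hp⟩ := hf
  refine ⟨⟨q, fun c => ?_⟩, p, fun c => t.eval (size c), PolyBdd.eval t PolyBdd.size, fun c r => ?_⟩
  · obtain ⟨a, h₁, h₂⟩ := h c
    have := hq a
    simp only [size, h₁, h₂] at this
    exact this
  · obtain ⟨a, h₁, h₂⟩ := h c
    have := (hp a r).mono (hT a)
    simp only [str, size, h₁, h₂] at this
    exact this

@[fun_prop]
theorem id : PolyTime fun x : α => x :=
  ⟨PolyBdd.size, .peek .a, fun _ => 1, PolyBdd.const 1, fun _ _ v => ⟨_, 1, le_rfl, .peek .a v _⟩⟩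

@[fun_prop]
theorem comp {g : β → γ} {f : α → β} (hg : PolyTime g) (hf : PolyTime f) :
    PolyTime fun x => g (f x) := by
  obtain ⟨hg₁, p, T, hT, hp⟩ := hg
  obtain ⟨hf₁, q, U, hU, hq⟩ := hf
  exact ⟨hg₁.comp hf₁, .seq q p, fun a => U a + T (f a), hU.add (hT.comp hf₁),
    fun a r => (hq a r).seq (hp (f a) r)⟩

@[fun_prop]
theorem const (y : β) : PolyTime fun _ : α => y := by
  refine ⟨PolyBdd.const _, .seq drop (write (str y)), fun a => 8 * size a + 5 + (size y + 1),
    (((PolyBdd.const 8).mul PolyBdd.size).add (PolyBdd.const 5)).add (PolyBdd.const _),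
    fun a r => ?_⟩
  exact (run_drop _ r).seq (run_write _ _ _ _ _)

@[fun_prop]
theorem prodMk {f : α → β} {g : α → γ} (hf : PolyTime f) (hg : PolyTime g) :
    PolyTime fun x => (f x, g x) := by
  obtain ⟨hf₁, p, T, hT, hp⟩ := hf
  obtain ⟨hg₁, q, U, hU, hq⟩ := hg
  have hb : PolyBdd fun a => size (f a) + size (g a) + 1 := (hf₁.add hg₁).add (PolyBdd.const 1)
  refine ⟨hb.of_le fun a => (size_prod _).le,
    -- At the end the value of `f` lies directly above that of `g`, so a single node symbol on top
    -- makes the tree of the pair.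
    .seq dup (.seq q (.seq swap (.seq p (.push .a fun _ => .bit true)))),
    fun a => 16 * size a + 9 + (U a + (15 * size (g a) + 15 * size a + 20 + (T a + 1))), ?_,
    fun a r => ?_⟩
  · exact (((PolyBdd.const 16).mul PolyBdd.size).add (PolyBdd.const 9)).add
      (hU.add (((((PolyBdd.const 15).mul hg₁).add ((PolyBdd.const 15).mul PolyBdd.size)).add
        (PolyBdd.const 20)).add (hT.add (PolyBdd.const 1))))
  · have := (run_dup (Code.tr a) r).seq ((hq a (str a ++ r)).seq
      ((run_swap (Code.tr (g a)) (Code.tr a) r).seq ((hp a (str (g a) ++ r)).seq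
        (run_push .a (.bit true) _))))
    simp only [stacks_a, update_stacks_a] at this
    rw [← List.append_assoc, ← List.cons_append] at this
    exact this

/-- Functions that distinguish whether the tree for the argument is a leaf. -/
theorem of_tr_cases {f : α → β} {g : Tr × Tr → β} {y : β} (hg : ∃ p : Prog, ∃ T : Tr × Tr → ℕ,
      PolyBdd T ∧ ∀ (a : Tr × Tr) (r : List Γ'),
        Run p (stk (a.1.str ++ (a.2.str ++ r)) [] [] []) (T a) (stk (str (g a) ++ r) [] [] []))
    (hg₁ : PolyBdd fun x => size (g x))
    (hleaf : ∀ a, Code.tr a = .leaf → f a = y)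
    (hnode : ∀ a x x', Code.tr a = .node x x' → f a = g (x, x')) : PolyTime f := by
  obtain ⟨p, T, ⟨t, ht⟩, hp⟩ := hg
  obtain ⟨q, hq⟩ := hg₁
  refine ⟨⟨q + .C (size y), fun a => ?_⟩,
    -- Popping the first symbol of a node leaves its two subtrees as separate trees on the stack;
    -- popping that of a leaf leaves nothing of it.
    popCase .a fun v => if v = some (.bit true) then p else write (str y),
    fun a => t.eval (size a) + (size y + 1) + 2, ?_, fun a r => run_popCase ?_⟩
  · rcases h : Code.tr a with _ | ⟨x, x'⟩
    · simp [hleaf a h]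
    · beta_reduce
      rw [hnode a x x' h]
      have := hq (x, x')
      have e : size (x, x') = size a := by
        simp only [size, h]
        rfl
      rw [e] at this
      simp only [Polynomial.eval_add, Polynomial.eval_C] at this ⊢
      omega
  · exact ((PolyBdd.eval t PolyBdd.size).add (PolyBdd.const _)).add (PolyBdd.const 2)
  · rcases h : Code.tr a with _ | ⟨x, x'⟩
    · rw [hleaf a h]
      have := run_write (str y) r [] [] []
      simp only [str, h, Tr.str, stacks_a, update_stacks_a, List.cons_append, List.head?_cons,
        List.tail_cons, List.nil_append]
      exact this.mono (by simp only [str, size, Tr.size]; omega)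
    · rw [hnode a x x' h]
      have := (hp (x, x') r).mono (ht _)
      have e : size (x, x') = size a := by
        simp only [size, h]
        rfl
      rw [e] at this
      simp only [str, h, Tr.str, stacks_a, update_stacks_a, List.cons_append, List.head?_cons,
        List.tail_cons, List.append_assoc, if_true]
      exact this.mono (by omega)

/-! ### Taking trees apart. -/

/-- The left subtree. -/
def left : Tr → Tr
  | .leaf => .leaf
  | .node x _ => x

/-- The right subtree. -/
def right : Tr → Tr
  | .leaf => .leaf
  | .node _ y => y

/-- Whether the tree for an element is not a leaf. -/
def isNode (x : α) : Bool :=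
  match Code.tr x with
  | .leaf => false
  | .node _ _ => true

theorem left_tr : PolyTime left := by
  refine of_tr_cases (g := Prod.fst) (y := .leaf) ⟨.seq swap drop,
    fun a => 15 * size a + 20 + (8 * size a + 5), ?_, fun a r => ?_⟩
    (PolyBdd.size.of_le fun a => by simp; omega) ?_ ?_
  · exact (((PolyBdd.const 15).mul PolyBdd.size).add (PolyBdd.const 20)).add
      (((PolyBdd.const 8).mul PolyBdd.size).add (PolyBdd.const 5))
  · refine ((run_swap a.1 a.2 r).seq (run_drop a.2 _)).mono ?_
    have : size a = a.1.size + a.2.size + 1 := size_prod a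
    beta_reduce
    omega
  · rintro a h; change a = _ at h; rw [h]; rfl
  · rintro a x x' h; change a = _ at h; rw [h]; rfl

theorem right_tr : PolyTime right := by
  refine of_tr_cases (g := Prod.snd) (y := .leaf) ⟨drop,
    fun a => 8 * size a + 5, ?_, fun a r => ?_⟩
    (PolyBdd.size.of_le fun a => by simp; omega) ?_ ?_
  · exact ((PolyBdd.const 8).mul PolyBdd.size).add (PolyBdd.const 5)
  · refine (run_drop a.1 _).mono ?_
    have : size a = a.1.size + a.2.size + 1 := size_prod a
    beta_reduce
    omega
  · rintro a h; change a = _ at h; rw [h]; rfl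
  · rintro a x x' h; change a = _ at h; rw [h]; rfl

theorem isNode_polyTime : PolyTime (isNode : α → Bool) := by
  refine of_tr_cases (g := fun _ => true) (y := false) ⟨.seq drop (.seq drop (write (str true))),
    fun a => 8 * size a + 5 + (8 * size a + 5 + 4), ?_, fun a r => ?_⟩
    (PolyBdd.const 3) ?_ ?_
  · exact (((PolyBdd.const 8).mul PolyBdd.size).add (PolyBdd.const 5)).add
      ((((PolyBdd.const 8).mul PolyBdd.size).add (PolyBdd.const 5)).add (PolyBdd.const 4))
  · refine ((run_drop a.1 _).seq ((run_drop a.2 _).seq (run_write _ _ _ _ _))).mono ?_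
    have : size a = a.1.size + a.2.size + 1 := size_prod a
    beta_reduce
    have : (str true).length = 3 := rfl
    omega
  · intro a h; simp [isNode, h]
  · intro a x x' h; simp [isNode, h]

@[fun_prop]
theorem fst : PolyTime fun x : α × β => x.1 :=
  left_tr.of_tr_eq fun x => ⟨Code.tr x, rfl, rfl⟩

@[fun_prop]
theorem snd : PolyTime fun x : α × β => x.2 :=
  right_tr.of_tr_eq fun x => ⟨Code.tr x, rfl, rfl⟩

/-! ### Tests, branching and loops. -/

/-- Evaluate a test on the topmost tree, keep the tree, and move the answer to the register. -/
def testProg (p : Prog) : Prog :=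
  .seq dup (.seq p (popCase .a fun v => if v = some (.bit true)
    then .seq (.pop .a) (.seq (.pop .a) (.seq (.push .a fun _ => .bit true) (.pop .a)))
    else .case fun _ => .case fun _ => .seq (.push .a fun _ => .bit false) (.pop .a)))

/-- The string of `true` has three symbols and that of `false` has one, so two more symbols are
removed for `true`. These overwrite the register, and a push followed by a pop restores the answer.
The two idle `case`s make both branches equally long. -/
theorem exec_testProg {p : Prog} {test : α → Bool} {T : α → ℕ}
    (hp : ∀ a r, Run p (stk (str a ++ r) [] [] []) (T a) (stk (str (test a) ++ r) [] [] []))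
    (a : α) (r : List Γ') (v : Reg) :
    ∃ t ≤ 16 * size a + 15 + T a, Exec (testProg p) v (stk (str a ++ r) [] [] []) t
      (some (.bit (test a))) (stk (str a ++ r) [] [] []) := by
  obtain ⟨v₁, t₁, ht₁, h₁⟩ := run_dup (Code.tr a) r v
  obtain ⟨v₂, t₂, ht₂, h₂⟩ := hp a (str a ++ r) v₁
  have : (Code.tr a).size = size a := rfl
  rcases h : test a
  · refine ⟨t₁ + (t₂ + (1 + (1 + 1 + 1 + 1 + 1))), by omega, h₁.seq (h₂.seq ?_)⟩
    rw [h]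
    refine .seq (.pop .a _ _) (.case ?_)
    exact .case (.case (.seq (.push _ _ _ _) (by
      have := Exec.pop .a (some (.bit false)) (stk (.bit false :: (str a ++ r)) [] [] [])
      simp only [stacks_a, update_stacks_a, List.head?_cons, List.tail_cons] at this
      simpa [str, Code.tr, Tr.str] using this)))
  · refine ⟨t₁ + (t₂ + (1 + (1 + (1 + (1 + 1)) + 1))), by omega, h₁.seq (h₂.seq ?_)⟩
    rw [h]
    have h₃ := Exec.pop .a v₂ (stk (.bit true :: .bit false :: .bit false :: (str a ++ r)) [] [] [])
    have h₄ := Exec.pop .a (some (.bit true))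
      (stk (.bit false :: .bit false :: (str a ++ r)) [] [] [])
    have h₅ := Exec.pop .a (some (.bit false)) (stk (.bit false :: (str a ++ r)) [] [] [])
    have h₆ := Exec.push .a (fun _ => .bit true) (some (.bit false)) (stk (str a ++ r) [] [] [])
    have h₇ := Exec.pop .a (some (.bit false)) (stk (.bit true :: (str a ++ r)) [] [] [])
    simp only [stacks_a, update_stacks_a, List.head?_cons, List.tail_cons] at h₃ h₄ h₅ h₆ h₇
    exact .seq h₃ (.case (.seq h₄ (.seq h₅ (.seq h₆ h₇))))

/-- The branches may have domains other than `α`, as only trees matter. A nonempty list can thus be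
treated as the pair of its head and tail, which has the same tree. -/
theorem ite_aux {test : α → Bool} {f : α → β} {g : γ → β} {h : δ → β}
    (ht : PolyTime test) (hg : PolyTime g) (hh : PolyTime h)
    (h₁ : ∀ a, test a = true → ∃ c, Code.tr c = Code.tr a ∧ f a = g c)
    (h₂ : ∀ a, test a = false → ∃ c, Code.tr c = Code.tr a ∧ f a = h c) : PolyTime f := by
  obtain ⟨-, p, T, hT, hp⟩ := ht
  obtain ⟨⟨q₁, hq₁⟩, p₁, T₁, ⟨t₁, hT₁⟩, hp₁⟩ := hg
  obtain ⟨⟨q₂, hq₂⟩, p₂, T₂, ⟨t₂, hT₂⟩, hp₂⟩ := hh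
  refine ⟨⟨q₁ + q₂, fun a => ?_⟩,
    .seq (testProg p) (.case fun v => if v = some (.bit true) then p₁ else p₂),
    fun a => 16 * size a + 15 + T a + (t₁.eval (size a) + t₂.eval (size a) + 1), ?_,
    fun a r v => ?_⟩
  · rcases h : test a
    · obtain ⟨c, hc, e⟩ := h₂ a h
      have := hq₂ c
      beta_reduce
      rw [e]
      simp only [size, hc, Polynomial.eval_add] at this ⊢
      omega
    · obtain ⟨c, hc, e⟩ := h₁ a h
      have := hq₁ c
      beta_reduce
      rw [e]
      simp only [size, hc, Polynomial.eval_add] at this ⊢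
      omega
  · exact ((((PolyBdd.const 16).mul PolyBdd.size).add (PolyBdd.const 15)).add hT).add
      (((PolyBdd.eval t₁ PolyBdd.size).add (PolyBdd.eval t₂ PolyBdd.size)).add (PolyBdd.const 1))
  · obtain ⟨t, ht, e⟩ := exec_testProg hp a r v
    rcases h : test a
    · obtain ⟨c, hc, e'⟩ := h₂ a h
      obtain ⟨v', t', ht', e''⟩ := (hp₂ c r).mono (hT₂ c) (some (.bit false))
      simp only [size, str, hc] at ht' e''
      rw [h] at e
      refine ⟨v', t + (t' + 1), ?_, e.seq (.case ?_)⟩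
      · simp only [size] at ht ⊢
        omega
      · simpa [e'] using e''
    · obtain ⟨c, hc, e'⟩ := h₁ a h
      obtain ⟨v', t', ht', e''⟩ := (hp₁ c r).mono (hT₁ c) (some (.bit true))
      simp only [size, str, hc] at ht' e''
      rw [h] at e
      refine ⟨v', t + (t' + 1), ?_, e.seq (.case ?_)⟩
      · simp only [size] at ht ⊢
        omega
      · simpa [e'] using e''

/-- Iterate a function while a test holds. -/
theorem while_loop {test : α → Bool} {body : α → α} {s f : β → α} (ht : PolyTime test)
    (hb : PolyTime body) (hs : PolyTime s) (N Q : β → ℕ) (hN : PolyBdd N) (hQ : PolyBdd Q)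
    (h : ∀ b, ∃ n ≤ N b, (∀ i < n, test (body^[i] (s b)) = true) ∧
      test (body^[n] (s b)) = false ∧ (∀ i ≤ n, size (body^[i] (s b)) ≤ Q b) ∧
      f b = body^[n] (s b)) : PolyTime f := by
  obtain ⟨-, p, T, ⟨t, hT⟩, hp⟩ := ht
  obtain ⟨-, q, U, ⟨u, hU⟩, hq⟩ := hb
  obtain ⟨-, p₀, V, hV, hp₀⟩ := hs
  -- A bound for one round of the loop, that is one body and one test, on states of size at most
  -- `s`.
  let C : ℕ → ℕ := fun s => 16 * s + 15 + t.eval s + u.eval s + 1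
  refine ⟨hQ.of_le fun a => ?_, .seq p₀ (.seq (testProg p)
    (.loop (fun v => decide (v = some (.bit true))) (.seq q (testProg p)))),
    fun a => V a + (N a + 1) * C (Q a), ?_, fun a r v => ?_⟩
  · obtain ⟨n, -, -, -, h₃, h₄⟩ := h a
    rw [h₄]
    exact h₃ n le_rfl
  · exact hV.add <| (hN.add (PolyBdd.const 1)).mul ((((((PolyBdd.const 16).mul hQ).add
      (PolyBdd.const 15)).add (PolyBdd.eval t hQ)).add (PolyBdd.eval u hQ)).add (PolyBdd.const 1))
  · obtain ⟨n, hn, h₁, h₂, h₃, h₄⟩ := h a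
    have key : ∀ n a, (∀ i < n, test (body^[i] a) = true) → test (body^[n] a) = false →
        ∀ K, (∀ i ≤ n, size (body^[i] a) ≤ K) → ∃ v' t, t ≤ n * C K + 1 ∧
        Exec (.loop (fun v => decide (v = some (.bit true))) (.seq q (testProg p)))
          (some (.bit (test a))) (stk (str a ++ r) [] [] []) t v'
          (stk (str (body^[n] a) ++ r) [] [] []) := by
      intro n
      induction n with
      | zero =>
        intro a _ h₂ K _
        refine ⟨some (.bit (test a)), 1, by omega, .loop_exit _ ?_⟩
        simpa using h₂
      | succ n ih =>
        intro a h₁ h₂ K h₃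
        obtain ⟨v', t', ht', e⟩ := ih (body a) (fun i hi => h₁ (i + 1) (by omega)) h₂ K
          (fun i hi => h₃ (i + 1) (by omega))
        have h₄ := h₁ 0 (by omega)
        have h₅ := h₃ 0 (by omega)
        have h₆ := h₃ 1 (by omega)
        simp only [Function.iterate_zero, Function.iterate_one, id_eq] at h₄ h₅ h₆
        obtain ⟨v₁, t₁, ht₁, e₁⟩ := hq a r (some (.bit (test a)))
        obtain ⟨t₂, ht₂, e₂⟩ := exec_testProg hp (body a) r v₁
        refine ⟨v', _, ?_, .loop_step (by simp [h₄]) (e₁.seq e₂) e⟩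
        have h₇ := (hU a).trans (eval_mono u h₅)
        have h₈ := (hT (body a)).trans (eval_mono t h₆)
        simp only [C, Nat.add_mul] at ht' ⊢
        omega
    obtain ⟨v₀, t₀, ht₀, e₀⟩ := hp₀ a r v
    obtain ⟨t₁, ht₁, e₁⟩ := exec_testProg hp (s a) r v₀
    obtain ⟨v', t', ht', e'⟩ := key n (s a) h₁ h₂ (Q a) h₃
    rw [h₄]
    refine ⟨v', t₀ + (t₁ + t'), ?_, e₀.seq (e₁.seq e')⟩
    have h₅ : size (s a) ≤ Q a := h₃ 0 (by omega)
    have h₇ := (hT (s a)).trans (eval_mono t h₅)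
    have h₈ : n * C (Q a) ≤ N a * C (Q a) := Nat.mul_le_mul_right _ hn
    have h₉ : 16 * size (s a) + 15 + t.eval (Q a) + 1 ≤ C (Q a) := by
      simp only [C]
      omega
    beta_reduce
    rw [Nat.add_mul]
    omega

/-! ## Closure properties -/

theorem tr_cons (a : α) (l : List α) : Code.tr (a :: l) = .node (Code.tr a) (Code.tr l) := rfl
theorem tr_succ (n : ℕ) : Code.tr (n + 1) = .node .leaf (Code.tr n) := rfl

@[fun_prop]
theorem cond {t : α → Bool} {f g : α → β} (ht : PolyTime t) (hf : PolyTime f) (hg : PolyTime g) :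
    PolyTime fun x => bif t x then f x else g x :=
  ite_aux ht hf hg (fun a h => ⟨a, rfl, by simp [h]⟩) (fun a h => ⟨a, rfl, by simp [h]⟩)

@[fun_prop]
theorem and {s t : α → Bool} (hs : PolyTime s) (ht : PolyTime t) :
    PolyTime fun x => s x && t x := by
  have : PolyTime fun x => bif s x then t x else false := by fun_prop
  convert this using 2 with x
  cases s x <;> rfl

@[fun_prop]
theorem or {s t : α → Bool} (hs : PolyTime s) (ht : PolyTime t) :
    PolyTime fun x => s x || t x := by
  have : PolyTime fun x => bif s x then true else t x := by fun_prop
  convert this using 2 with x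
  cases s x <;> rfl

@[fun_prop]
theorem not {s : α → Bool} (hs : PolyTime s) : PolyTime fun x => !s x := by
  have : PolyTime fun x => bif s x then false else true := by fun_prop
  convert this using 2 with x
  cases s x <;> rfl

@[fun_prop]
theorem beq_bool {s t : α → Bool} (hs : PolyTime s) (ht : PolyTime t) :
    PolyTime fun x => s x == t x := by
  have : PolyTime fun x => bif s x then t x else !t x := by fun_prop
  convert this using 2 with x
  cases s x <;> cases t x <;> rfl

@[fun_prop]
theorem cons {f : α → β} {g : α → List β} (hf : PolyTime f) (hg : PolyTime g) :
    PolyTime fun x => f x :: g x :=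
  (hf.prodMk hg).of_tr_eq fun x => ⟨x, rfl, rfl⟩

@[fun_prop]
theorem succ {f : α → ℕ} (hf : PolyTime f) : PolyTime fun x => f x + 1 :=
  ((const ()).prodMk hf).of_tr_eq fun x => ⟨x, rfl, rfl⟩

@[fun_prop]
theorem isEmpty {f : α → List β} (hf : PolyTime f) : PolyTime fun x => (f x).isEmpty := by
  have : PolyTime fun x => !isNode (f x) := not (isNode_polyTime.comp hf)
  convert this using 2 with x
  cases f x <;> rfl

@[fun_prop]
theorem tail {f : α → List β} (hf : PolyTime f) : PolyTime fun x => (f x).tail := by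
  have : PolyTime (List.tail : List β → List β) := right_tr.of_tr_eq fun l => ⟨Code.tr l, rfl, by
    cases l <;> rfl⟩
  exact this.comp hf

@[fun_prop]
theorem headD {f : α → List β} {g : α → β} (hf : PolyTime f) (hg : PolyTime g) :
    PolyTime fun x => (f x).headD (g x) := by
  have : PolyTime fun x : List β × β => x.1.headD x.2 := by
    refine ite_aux (γ := List β × β) (δ := (β × List β) × β) (isEmpty fst) snd
      (fst.comp fst) (fun x h => ⟨x, rfl, ?_⟩) ?_
    · rcases x with ⟨_ | ⟨a, l⟩, b⟩
      · rfl
      · simp at h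
    · rintro ⟨_ | ⟨a, l⟩, b⟩ h
      · simp at h
      · exact ⟨((a, l), b), rfl, rfl⟩
  exact this.comp (hf.prodMk hg)

/-! ## Recursion on lists -/

theorem size_drop_le (i : ℕ) (l : List α) : size (l.drop i) ≤ size l := by
  induction i generalizing l with
  | zero => simp
  | succ i ih =>
    cases l with
    | nil => simp
    | cons a l =>
      have := ih l
      simp only [List.drop_succ_cons, size_cons]
      omega

/-- A loop with a polynomial bound for the size of the accumulator. -/
theorem foldl {F : γ → β → α → β} {l : γ → List α} {init : γ → β}
    (hF : PolyTime fun x : γ × β × α => F x.1 x.2.1 x.2.2) (hl : PolyTime l)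
    (hi : PolyTime init) (Q : γ → ℕ) (hQ : PolyBdd Q)
    (h : ∀ c i, size (((l c).take i).foldl (F c) (init c)) ≤ Q c) :
    PolyTime fun c => (l c).foldl (F c) (init c) := by
  -- The state of the loop consists of the unread part of the list, the accumulator and the
  -- parameter.
  let body : List α × β × γ → List α × β × γ := fun s =>
    match s.1 with
    | [] => s
    | a :: l => (l, F s.2.2 s.2.1 a, s.2.2)
  have hbody : PolyTime body := by
    refine ite_aux (γ := List α × β × γ) (δ := (α × List α) × β × γ) (isEmpty fst) id
      (h := fun s => (s.1.2, F s.2.2 s.2.1 s.1.1, s.2.2)) ?_ (fun s h => ⟨s, rfl, ?_⟩) ?_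
    · exact (snd.comp fst).prodMk ((hF.comp ((snd.comp snd).prodMk
        ((fst.comp snd).prodMk (fst.comp fst)))).prodMk (snd.comp snd))
    · rcases s with ⟨_ | ⟨a, l⟩, b, c⟩
      · rfl
      · simp at h
    · rintro ⟨_ | ⟨a, l⟩, b, c⟩ h
      · simp at h
      · exact ⟨((a, l), b, c), rfl, rfl⟩
  have hiter : ∀ (i : ℕ) (l : List α) (b : β) (c : γ),
      body^[i] (l, b, c) = (l.drop i, (l.take i).foldl (F c) b, c) := by
    intro i
    induction i with
    | zero => intro l b c; simp
    | succ i ih =>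
      intro l b c
      rw [Function.iterate_succ_apply]
      cases l with
      | nil => simp only [body]; rw [ih]; simp
      | cons a l => simp only [body]; rw [ih]; simp
  have hmain : PolyTime fun c => ((([] : List α), (l c).foldl (F c) (init c), c) :
      List α × β × γ) := by
    refine while_loop (test := fun s => !s.1.isEmpty) (body := body)
      (s := fun c => (l c, init c, c)) (by fun_prop) hbody (hl.prodMk (hi.prodMk id))
      (fun c => size (l c)) (fun c => size (l c) + (Q c + size c + 1) + 1) hl.size_bdd
      ((hl.size_bdd.add ((hQ.add PolyBdd.size).add (PolyBdd.const 1))).add (PolyBdd.const 1))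
      fun c => ⟨(l c).length, length_le_size _, ?_, ?_, ?_, ?_⟩
    · intro i hi
      rw [hiter]
      simp [hi]
    · rw [hiter]
      simp
    · intro i _
      rw [hiter]
      have h₁ := h c i
      have h₂ := size_drop_le i (l c)
      simp only [size_prod]
      omega
    · rw [hiter]
      simp
  exact (fst.comp snd).comp hmain

/-- A loop in which every step only adds a polynomial amount to the size. -/
theorem foldl_of_add {F : γ → β → α → β} {l : γ → List α} {init : γ → β}
    (hF : PolyTime fun x : γ × β × α => F x.1 x.2.1 x.2.2) (hl : PolyTime l)
    (hi : PolyTime init) (G : γ × α → ℕ) (hG : PolyBdd G)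
    (h : ∀ c b a, size (F c b a) ≤ size b + G (c, a)) :
    PolyTime fun c => (l c).foldl (F c) (init c) := by
  obtain ⟨p, hp⟩ := hG
  have hb : PolyBdd fun c => p.eval (size c + size (l c) + 1) :=
    PolyBdd.eval p ((PolyBdd.size.add hl.size_bdd).add (PolyBdd.const 1))
  refine foldl hF hl hi (fun c => size (init c) + size (l c) * p.eval (size c + size (l c) + 1))
    (hi.size_bdd.add (hl.size_bdd.mul hb)) fun c i => ?_
  -- The increment `G (c, a)` does not depend on the accumulator, so increments add up and do not
  -- compound.
  have key : ∀ (l' : List α) (b : β), (∀ a ∈ l', a ∈ l c) →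
      size (l'.foldl (F c) b) ≤ size b + l'.length * p.eval (size c + size (l c) + 1) := by
    intro l'
    induction l' with
    | nil => simp
    | cons a l' ih =>
      intro b hl'
      have h₁ := ih (F c b a) fun a' ha' => hl' a' (by simp [ha'])
      have h₂ := h c b a
      have h₃ := (hp (c, a)).trans (eval_mono p (n := size c + size (l c) + 1) (by
        have := size_le_of_mem (hl' a (by simp))
        simp only [size_prod]
        omega))
      simp only [List.foldl_cons, List.length_cons, Nat.add_mul]
      omega
  have h₁ := key ((l c).take i) (init c) fun a ha => List.mem_of_mem_take ha
  have h₂ : ((l c).take i).length ≤ size (l c) :=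
    (List.length_take_le' _ _).trans (length_le_size _)
  exact h₁.trans (Nat.add_le_add_left (Nat.mul_le_mul_right _ h₂) _)

@[fun_prop]
theorem reverse {f : α → List β} (hf : PolyTime f) : PolyTime fun x => (f x).reverse := by
  have : PolyTime fun x => (f x).foldl (fun b a => a :: b) [] := by
    refine foldl_of_add (F := fun _ b a => a :: b) (by fun_prop) hf (by fun_prop)
      (fun x => size x) PolyBdd.size fun c b a => ?_
    simp only [size_cons, size_prod]
    omega
  convert this using 2 with x
  rw [List.foldl_flip_cons_eq_append', List.append_nil]

/-- `foldl_of_add` for folding from the right. -/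
theorem foldr_of_add {F : γ → α → β → β} {l : γ → List α} {init : γ → β}
    (hF : PolyTime fun x : γ × β × α => F x.1 x.2.2 x.2.1) (hl : PolyTime l)
    (hi : PolyTime init) (G : γ × α → ℕ) (hG : PolyBdd G)
    (h : ∀ c b a, size (F c a b) ≤ size b + G (c, a)) :
    PolyTime fun c => (l c).foldr (F c) (init c) := by
  have := foldl_of_add (F := fun c b a => F c a b) hF (reverse hl) hi G hG h
  convert this using 2 with c
  rw [List.foldl_reverse]

/-- A loop with a truth value as accumulator. -/
theorem foldr_bool {F : γ → α → Bool → Bool} {l : γ → List α} {init : γ → Bool}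
    (hF : PolyTime fun x : γ × Bool × α => F x.1 x.2.2 x.2.1) (hl : PolyTime l)
    (hi : PolyTime init) : PolyTime fun c => (l c).foldr (F c) (init c) :=
  foldr_of_add hF hl hi (fun _ => 3) (PolyBdd.const 3) fun c b a => by
    have := size_bool_le (F c a b)
    omega

theorem any {F : γ → α → Bool} {l : γ → List α} (hF : PolyTime fun x : γ × α => F x.1 x.2)
    (hl : PolyTime l) : PolyTime fun c => (l c).any (F c) := by
  have : PolyTime fun c => (l c).foldr (fun a b => F c a || b) false := by
    refine foldr_bool (F := fun c a b => F c a || b) ?_ hl (const _)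
    exact or (hF.comp (fst.prodMk (snd.comp snd))) (fst.comp snd)
  convert this using 2 with c
  induction l c with
  | nil => rfl
  | cons a l ih => simp [ih]

theorem filter {F : γ → α → Bool} {l : γ → List α} (hF : PolyTime fun x : γ × α => F x.1 x.2)
    (hl : PolyTime l) : PolyTime fun c => (l c).filter (F c) := by
  have : PolyTime fun c => (l c).foldr (fun a b => bif F c a then a :: b else b) [] := by
    refine foldr_of_add (F := fun c a b => bif F c a then a :: b else b) ?_ hl (const _)
      (fun x => size x) PolyBdd.size fun c b a => ?_
    · exact cond (hF.comp (fst.prodMk (snd.comp snd))) (cons (snd.comp snd) (fst.comp snd))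
        (fst.comp snd)
    · cases F c a
      · simp
      · simp only [cond_true, size_cons, size_prod]
        omega
  convert this using 2 with c
  induction l c with
  | nil => rfl
  | cons a l ih => cases h : F c a <;> simp only [List.filter_cons, List.foldr_cons, h, ih] <;> rfl

theorem map {F : γ → α → β} {l : γ → List α} (hF : PolyTime fun x : γ × α => F x.1 x.2)
    (hl : PolyTime l) : PolyTime fun c => (l c).map (F c) := by
  have : PolyTime fun c => (l c).foldr (fun a b => F c a :: b) [] := by
    refine foldr_of_add (F := fun c a b => F c a :: b) ?_ hl (const _)
      (fun x => size (F x.1 x.2) + 1) (hF.size_bdd.add (PolyBdd.const 1)) fun c b a => ?_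
    · exact cons (hF.comp (fst.prodMk (snd.comp snd))) (fst.comp snd)
    · simp only [size_cons]
      omega
  convert this using 2 with c
  induction l c with
  | nil => rfl
  | cons a l ih => simp only [List.map_cons, List.foldr_cons, ih]

@[fun_prop]
theorem append {f g : γ → List α} (hf : PolyTime f) (hg : PolyTime g) :
    PolyTime fun c => f c ++ g c := by
  have : PolyTime fun c => (f c).foldr (fun a b => a :: b) (g c) := by
    refine foldr_of_add (F := fun _ a b => a :: b) (by fun_prop) hf hg
      (fun x => size x) PolyBdd.size fun c b a => ?_
    simp only [size_cons, size_prod]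
    omega
  convert this using 2 with c
  induction f c with
  | nil => rfl
  | cons a l ih => simp only [List.cons_append, List.foldr_cons, ih]

theorem flatMap {F : γ → α → List β} {l : γ → List α} (hF : PolyTime fun x : γ × α => F x.1 x.2)
    (hl : PolyTime l) : PolyTime fun c => (l c).flatMap (F c) := by
  have happ : ∀ l l' : List β, size (l ++ l') ≤ size l + size l' := by
    intro l l'
    induction l with
    | nil => simp
    | cons a l ih => simp only [List.cons_append, size_cons]; omega
  have : PolyTime fun c => (l c).foldr (fun a b => F c a ++ b) [] := by
    refine foldr_of_add (F := fun c a b => F c a ++ b) ?_ hl (const _)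
      (fun x => size (F x.1 x.2)) hF.size_bdd fun c b a => ?_
    · exact append (hF.comp (fst.prodMk (snd.comp snd))) (fst.comp snd)
    · have := happ (F c a) b
      dsimp only
      omega
  convert this using 2 with c
  induction l c with
  | nil => rfl
  | cons a l ih => simp only [List.flatMap_cons, List.foldr_cons, ih]

@[fun_prop]
theorem length {f : γ → List α} (hf : PolyTime f) : PolyTime fun c => (f c).length := by
  have : PolyTime fun c => (f c).foldr (fun _ n => n + 1) 0 := by
    refine foldr_of_add (F := fun _ _ n => n + 1) (by fun_prop) hf (const _) (fun _ => 2)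
      (PolyBdd.const 2) fun c b a => ?_
    simp only [size_nat]
    omega
  convert this using 2 with c
  induction f c with
  | nil => rfl
  | cons a l ih => simp only [List.length_cons, List.foldr_cons, ih]

/-! ## Arithmetic -/

/-- A unary number and a list of that many units have the same tree. Recursion on numbers thereby
becomes folding over lists. -/
theorem replicate {f : γ → ℕ} (hf : PolyTime f) : PolyTime fun c => List.replicate (f c) () := by
  have : PolyTime fun n : ℕ => List.replicate n () := id.of_tr_eq fun n => ⟨n, rfl, by
    induction n with
    | zero => rfl
    | succ n ih => rw [List.replicate_succ, tr_cons, tr_succ, ih]; rfl⟩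
  exact this.comp hf

@[fun_prop]
theorem pred {f : γ → ℕ} (hf : PolyTime f) : PolyTime fun c => f c - 1 := by
  have := length (tail (replicate hf))
  simpa using this

@[fun_prop]
theorem sub {f g : γ → ℕ} (hf : PolyTime f) (hg : PolyTime g) : PolyTime fun c => f c - g c := by
  have : PolyTime fun c => (List.replicate (g c) ()).foldr (fun _ n => n - 1) (f c) := by
    refine foldr_of_add (F := fun _ _ n => n - 1) (by fun_prop) (replicate hg) hf (fun _ => 0)
      (PolyBdd.const 0) fun c b a => ?_
    simp only [size_nat]
    omega
  convert this using 2 with c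
  induction g c with
  | zero => rfl
  | succ n ih => rw [List.replicate_succ, List.foldr_cons, ← ih]; omega

@[fun_prop]
theorem beq_zero {f : γ → ℕ} (hf : PolyTime f) : PolyTime fun c => f c == 0 := by
  have := isEmpty (replicate hf)
  convert this using 2 with c
  cases f c <;> rfl

@[fun_prop]
theorem ble {f g : γ → ℕ} (hf : PolyTime f) (hg : PolyTime g) :
    PolyTime fun c => Nat.ble (f c) (g c) := by
  have := beq_zero (sub hf hg)
  convert this using 2 with c
  rw [Bool.eq_iff_iff]
  simp [Nat.sub_eq_zero_iff_le]

@[fun_prop]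
theorem half {f : γ → ℕ} (hf : PolyTime f) : PolyTime fun c => f c / 2 := by
  have : PolyTime fun c => ((List.replicate (f c) ()).foldr
      (fun _ (x : Bool × ℕ) => bif x.1 then (false, x.2 + 1) else (true, x.2)) (false, 0)).2 := by
    refine snd.comp (foldr_of_add
      (F := fun _ _ (x : Bool × ℕ) => bif x.1 then (false, x.2 + 1) else (true, x.2))
      (by fun_prop) (replicate hf) (const _) (fun _ => 2) (PolyBdd.const 2) fun c b a => ?_)
    obtain ⟨_ | _, b⟩ := b
    · simp; omega
    · simp; omega
  convert this using 2 with c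
  have key : ∀ n : ℕ, ((List.replicate n ()).foldr
      (fun _ (x : Bool × ℕ) => bif x.1 then (false, x.2 + 1) else (true, x.2)) (false, 0)) =
      (decide (n % 2 = 1), n / 2) := by
    intro n
    induction n with
    | zero => rfl
    | succ n ih =>
      rw [List.replicate_succ, List.foldr_cons, ih]
      rcases Nat.mod_two_eq_zero_or_one n with h | h
      · have h₁ : (n + 1) % 2 = 1 := by omega
        have h₂ : (n + 1) / 2 = n / 2 := by omega
        simp [h, h₁, h₂]
      · have h₁ : (n + 1) % 2 = 0 := by omega
        have h₂ : (n + 1) / 2 = n / 2 + 1 := by omega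
        simp [h, h₁, h₂]
  rw [key]

/-! ## Equality -/

/-- One step of the comparison of two lists of truth values. -/
def listEqStep (x : Bool × List Bool) (a : Bool) : Bool × List Bool :=
  (x.1 && !x.2.isEmpty && (a == x.2.headD false), x.2.tail)

/-- Equality of lists of truth values. -/
def listEq (l l' : List Bool) : Bool :=
  (l.foldl listEqStep (true, l')).1 && (l.foldl listEqStep (true, l')).2.isEmpty

theorem listEq_iff (l l' : List Bool) : listEq l l' = true ↔ l = l' := by
  have hfalse : ∀ l l' : List Bool, (l.foldl listEqStep (false, l')).1 = false := by
    intro l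
    induction l with
    | nil => exact fun _ => rfl
    | cons a l ih => exact fun l' => ih _
  induction l generalizing l' with
  | nil => cases l' <;> simp [listEq]
  | cons a l ih =>
    cases l' with
    | nil => simp [listEq, listEqStep, hfalse]
    | cons b l' =>
      have e : listEqStep (true, b :: l') a = (a == b, l') := rfl
      rw [listEq, List.foldl_cons, e]
      rcases eq_or_ne a b with h | h
      · subst h
        rw [beq_self_eq_true, ← listEq]
        exact (ih l').trans (by simp)
      · have : (a == b) = false := by simpa using h
        rw [this, hfalse]
        simp [h]

@[fun_prop]
theorem listEq_polyTime {f g : γ → List Bool} (hf : PolyTime f) (hg : PolyTime g) :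
    PolyTime fun c => listEq (f c) (g c) := by
  have : PolyTime fun c => (f c).foldl listEqStep (true, g c) := by
    refine foldl_of_add (F := fun _ => listEqStep) (by unfold listEqStep; fun_prop) hf
      (by fun_prop) (fun _ => 3) (PolyBdd.const 3) fun c b a => ?_
    have h₁ := size_bool_le (b.1 && !b.2.isEmpty && (a == b.2.headD false))
    have h₂ : size b.2.tail ≤ size b.2 := by simpa using size_drop_le 1 b.2
    simp only [listEqStep, size_prod] at h₁ ⊢
    omega
  exact and (fst.comp this) (isEmpty (snd.comp this))

end PolyTime

/-! ## From polynomial-time functions to machines -/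

/-- The symbols of the input as triples of truth values. -/
def sym : Γ' → Bool × Bool × Bool
  | .blank => (false, false, false)
  | .bit b => (true, b, false)
  | .bra => (false, true, false)
  -- The same triple as for `blank` does no harm, since `parseStep` skips it.
  | .ket => (false, false, false)
  | .comma => (false, false, true)

theorem size_sym_le (s : Γ') : size (sym s) ≤ 11 := by
  have h₁ := size_bool_le (sym s).1
  have h₂ := size_bool_le (sym s).2.1
  have h₃ := size_bool_le (sym s).2.2
  simp only [size_prod]
  omega

/-- One step of reading the input. -/
def readStep : Prog :=
  .seq (.case fun v => v.elim (.peek .a) fun s => write (.bit true :: str (sym s))) (.pop .c)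

/-- Replace the input by the tree for it. -/
def readInput : Prog :=
  .seq (flush .b .c) (.seq (write (str ([] : List (Bool × Bool × Bool))))
    (.seq (.pop .c) (.loop Option.isSome readStep)))

/-- After the flush the last symbol of the input is read first, so that prepending symbol by symbol
builds the list in the original order. -/
theorem run_readInput (l : List Γ') (v : Reg) : ∃ v' t, t ≤ 19 * l.length + 6 ∧
    Exec readInput v (stk [] l [] []) t v' (stk (str (l.map sym)) [] [] []) := by
  have hloop : ∀ (l : List Γ') (x : List (Bool × Bool × Bool)), ∃ t ≤ 16 * l.length + 1,
      Exec (.loop Option.isSome readStep) l.head? (stk (str x) [] l.tail []) t none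
        (stk (str ((l.reverse.map sym) ++ x)) [] [] []) := by
    intro l
    induction l with
    | nil => exact fun x => ⟨1, le_rfl, .loop_exit _ rfl⟩
    | cons s l ih =>
      intro x
      obtain ⟨t, ht, h₁⟩ := ih (sym s :: x)
      obtain ⟨v', t', ht', h₂⟩ := run_write (.bit true :: str (sym s)) (str x) [] l [] (some s)
      have h₃ := Exec.pop .c v' (stk (str (sym s :: x)) [] l [])
      simp only [stacks_c, update_stacks_c] at h₃
      have e : Γ'.bit true :: str (sym s) ++ str x = str (sym s :: x) := rfl
      rw [e] at h₂
      have h₄ : Exec (.case fun v => v.elim (.peek .a) fun s => write (.bit true :: str (sym s)))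
        (some s) _ (t' + 1) _ _ := .case h₂
      have h₅ := Exec.loop_step (p := Option.isSome) rfl (h₄.seq h₃) h₁
      have h₆ : (Γ'.bit true :: str (sym s)).length = size (sym s) + 1 := rfl
      have h₇ := size_sym_le s
      rw [h₆] at ht'
      have h₈ : (s :: l).reverse.map sym ++ x = l.reverse.map sym ++ sym s :: x := by simp
      rw [h₈]
      refine ⟨_, ?_, h₅⟩
      simp only [List.length_cons]
      omega
  obtain ⟨v₁, t₁, ht₁, h₁⟩ := run_flush (k := .b) (k' := .c) (by decide) (stk [] l [] []) v
  obtain ⟨v₂, t₂, ht₂, h₂⟩ := run_write (str ([] : List (Bool × Bool × Bool))) [] [] l.reverse [] v₁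
  have h₃ := Exec.pop .c v₂ (stk (str ([] : List (Bool × Bool × Bool))) [] l.reverse [])
  obtain ⟨t₄, ht₄, h₄⟩ := hloop l.reverse []
  simp only [stacks_b, stacks_c, update_stacks_b, update_stacks_c, List.append_nil,
    List.reverse_reverse, List.length_reverse] at h₁ h₂ h₃ h₄ ht₁ ht₄
  refine ⟨none, _, ?_, h₁.seq (h₂.seq (h₃.seq h₄))⟩
  have : (str ([] : List (Bool × Bool × Bool))).length = 1 := rfl
  omega

/-- A property is decidable in polynomial time if a polynomial-time function computes it from
the symbols of the input. -/
theorem decidableInPolyTime_of_polyTime {α : Type} {enc : α → List Γ'} {P : α → Prop}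
    {f : List (Bool × Bool × Bool) → Bool} (hf : PolyTime f)
    (h : ∀ x, f ((enc x).map sym) = true ↔ P x) : DecidableInPolyTime enc P := by
  obtain ⟨-, p, T, ⟨q, hq⟩, hp⟩ := hf
  refine decidableInPolyTime_of_exec (.seq readInput (.seq p (.seq (.pop .a)
    (.case fun v => if v = some (.bit true)
      then .seq (.pop .a) (.seq (.pop .a) (.seq (.push .a fun _ => .bit true) (.pop .a)))
      else .peek .a))))
    -- Each symbol has a tree of size at most 11 and one list node, so an input of length `X` has a
    -- tree of size at most `12 * X + 1`.
    (19 * .X + q.comp (12 * .X + 1) + 12) fun x => ?_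
  have e₀ : Function.update (fun _ => []) .b (enc x) = stk [] (enc x) [] [] := by
    funext k; cases k <;> rfl
  have e₁ : stk [] [] [] [] = fun _ => [] := by
    funext k; cases k <;> rfl
  rw [e₀, ← e₁]
  obtain ⟨v₁, t₁, ht₁, h₁⟩ := run_readInput (enc x) none
  obtain ⟨v₂, t₂, ht₂, h₂⟩ := hp ((enc x).map sym) [] v₁
  have hT : t₂ ≤ q.eval (12 * (enc x).length + 1) := by
    refine (ht₂.trans (hq _)).trans (eval_mono q ?_)
    refine (size_le_mul _ 11 ?_).trans (by simp; omega)
    intro a ha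
    obtain ⟨s, -, rfl⟩ := List.mem_map.1 ha
    exact size_sym_le s
  rw [List.append_nil, List.append_nil] at h₂
  rcases hf : f ((enc x).map sym)
  · rw [hf] at h₂
    have h₃ := Exec.pop .a v₂ (stk [.bit false] [] [] [])
    simp only [stacks_a, update_stacks_a, List.head?_cons, List.tail_cons] at h₃
    refine ⟨t₁ + (t₂ + (1 + (1 + 1))), ?_, none, ?_, h₁.seq (h₂.seq (h₃.seq (.case ?_)))⟩
    · simp
      omega
    · rw [← h x, hf]
      simp
    · exact .peek .a _ _
  · rw [hf] at h₂
    have h₃ := Exec.pop .a v₂ (stk [.bit true, .bit false, .bit false] [] [] [])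
    have h₄ := Exec.pop .a (some (.bit true)) (stk [.bit false, .bit false] [] [] [])
    have h₅ := Exec.pop .a (some (.bit false)) (stk [.bit false] [] [] [])
    have h₆ := Exec.push .a (fun _ => .bit true) (some (.bit false)) (stk [] [] [] [])
    have h₇ := Exec.pop .a (some (.bit false)) (stk [.bit true] [] [] [])
    simp only [stacks_a, update_stacks_a, List.head?_cons, List.tail_cons] at h₃ h₄ h₅ h₆ h₇
    refine ⟨t₁ + (t₂ + (1 + (1 + (1 + (1 + 1)) + 1))), ?_, some (.bit true), ?_,
      h₁.seq (h₂.seq (h₃.seq (.case (h₄.seq (h₅.seq (h₆.seq h₇))))))⟩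
    · simp
      omega
    · simp [← h x, hf]

open PolyTime

/-! ## The algorithms -/

/-- Names of candidates. -/
abbrev Name : Type := List Bool

/-- One step of parsing, from right to left. The list that is being read comes first, and so does
the name that is being read. -/
def parseStep (s : Bool × Bool × Bool) (x : List (List Name)) : List (List Name) :=
  -- Since reading goes from right to left, a comma begins a name, and an opening bracket completes
  -- a list. Closing brackets are not needed.
  bif s.1 then ((s.2.1 :: (x.headD []).headD []) :: (x.headD []).tail) :: x.tail
  else bif s.2.1 then [] :: x
  else bif s.2.2 then ([] :: x.headD []) :: x.tail
  else x

/-- The lists of names in a string; the first one is for the names outside brackets. -/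
def parse (l : List (Bool × Bool × Bool)) : List (List Name) := l.foldr parseStep [[]]

theorem size_headD_tail {α : Type} [Code α] (l : List α) (a : α) :
    size (l.headD a) + size l.tail ≤ size l + size a := by
  cases l with
  | nil => simp
  | cons b l => simp only [List.headD_cons, List.tail_cons, size_cons]; omega

theorem parse_polyTime : PolyTime parse := by
  refine foldr_of_add (F := fun _ s x => parseStep s x) (l := fun l => l) (init := fun _ => [[]])
    (by unfold parseStep; fun_prop) id (const _) (fun _ => 20) (PolyBdd.const 20) fun _ x s => ?_
  have h₁ := size_headD_tail x []
  have h₂ := size_headD_tail (x.headD []) []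
  have h₃ := size_bool_le s.2.1
  simp only [size_nil] at h₁ h₂
  rcases s with ⟨_ | _, _ | _, _ | _⟩ <;>
    simp only [parseStep, cond_true, cond_false, size_cons, size_nil] at h₃ ⊢ <;> omega

/-! ### The conflict order and the two algorithms. -/

/-- Whether `a` comes before `b` in a list. -/
def before (l : List Name) (a b : Name) : Bool :=
  -- The test for `b` comes first, so that no name is before itself.
  l.foldr (fun c r => bif listEq c b then false else bif listEq c a then true else r) false

@[fun_prop]
theorem before_polyTime {γ : Type} [Code γ] {l : γ → List Name} {a b : γ → Name}
    (hl : PolyTime l) (ha : PolyTime a) (hb : PolyTime b) :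
    PolyTime fun c => before (l c) (a c) (b c) :=
  foldr_bool (F := fun c d r => bif listEq d (b c) then false else
    bif listEq d (a c) then true else r) (by fun_prop) hl (const _)

/-- Whether the second of three votes, and only this one, ranks `b` above `a`. -/
def conflict (v : List Name × List Name × List Name) (a b : Name) : Bool :=
  before v.1 a b && before v.2.2 a b && before v.2.1 b a

@[fun_prop]
theorem conflict_polyTime {γ : Type} [Code γ] {v : γ → List Name × List Name × List Name}
    {a b : γ → Name} (hv : PolyTime v) (ha : PolyTime a) (hb : PolyTime b) :
    PolyTime fun c => conflict (v c) (a c) (b c) := by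
  unfold conflict
  fun_prop

/-- The elements of a list that are not minimal. -/
def strip (R : Name → Name → Bool) (l : List Name) : List Name :=
  l.filter fun y => l.any fun x => R x y

/-- Here `k` is a constant and not part of the input, so the iterate is a composition of `k`
polynomial-time functions. -/
theorem strip_iterate_polyTime (k : ℕ) : PolyTime
    fun c : (List Name × List Name × List Name) × List Name => (strip (conflict c.1))^[k] c.2 := by
  have h₁ : PolyTime fun c : (List Name × List Name × List Name) × List Name =>
      strip (conflict c.1) c.2 := by
    refine filter (F := fun (c : (List Name × List Name × List Name) × List Name) y =>
      c.2.any fun x => conflict c.1 x y) ?_ snd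
    exact any (F := fun (c : ((List Name × List Name × List Name) × List Name) × Name) x =>
      conflict c.1.1 x c.2) (by fun_prop) (by fun_prop)
  induction k with
  | zero => exact snd
  | succ k ih => exact ih.comp (fst.prodMk h₁)

/-- The elements of the table that are eligible for `x`, have a list of length at most `n`,
and have the shortest list among these: at most one of them. -/
def best (R : Name → Name → Bool) (n : ℕ) (x : Name) (t : List (Name × List Name)) :
    List (Name × List Name) :=
  t.foldr (fun e b => bif R x e.1 && Nat.ble e.2.length n &&
    (b.isEmpty || Nat.ble e.2.length (b.headD ([], [])).2.length) then [e] else b) []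

theorem best_polyTime {γ : Type} [Code γ] {v : γ → List Name × List Name × List Name} {n : γ → ℕ}
    {x : γ → Name} {t : γ → List (Name × List Name)} (hv : PolyTime v) (hn : PolyTime n)
    (hx : PolyTime x) (ht : PolyTime t) :
    PolyTime fun c => best (conflict (v c)) (n c) (x c) (t c) := by
  refine foldr_of_add (F := fun c (e : Name × List Name) b => bif conflict (v c) (x c) e.1 &&
    Nat.ble e.2.length (n c) && (b.isEmpty || Nat.ble e.2.length (b.headD ([], [])).2.length)
    then [e] else b) (by fun_prop) ht (const _) (fun x => size x + 2)
    (PolyBdd.size.add (PolyBdd.const 2)) fun c b a => ?_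
  cases conflict (v c) (x c) a.1 && Nat.ble a.2.length (n c) &&
    (b.isEmpty || Nat.ble a.2.length (b.headD ([], [])).2.length)
  · simp only [cond_false]
    omega
  · have : size (c, a) = size c + size a + 1 := size_prod _
    simp only [cond_true, size_cons, size_nil, this]
    omega

/-- One step of the auction algorithm for bipartite matching. The state consists of a list of
bidders and, for every item, the list of its successive owners, the present one first. The first
bidder takes an item that has had the fewest owners, and the owner of this item becomes a
bidder again. A bidder for whom every item has had more than `n` owners leaves. -/
def bid (R : Name → Name → Bool) (n : ℕ) (s : List Name × List (Name × List Name)) :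
    List Name × List (Name × List Name) :=
  bif s.1.isEmpty then s
  else bif (best R n (s.1.headD []) s.2).isEmpty then (s.1.tail, s.2)
  else (bif ((best R n (s.1.headD []) s.2).headD ([], [])).2.isEmpty then s.1.tail
      else ((best R n (s.1.headD []) s.2).headD ([], [])).2.headD [] :: s.1.tail,
    s.2.map fun e => bif listEq e.1 ((best R n (s.1.headD []) s.2).headD ([], [])).1
      then (e.1, s.1.headD [] :: e.2) else e)

theorem bid_polyTime {γ : Type} [Code γ] {v : γ → List Name × List Name × List Name} {n : γ → ℕ}
    {s : γ → List Name × List (Name × List Name)} (hv : PolyTime v) (hn : PolyTime n)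
    (hs : PolyTime s) : PolyTime fun c => bid (conflict (v c)) (n c) (s c) := by
  have hb : PolyTime fun c => best (conflict (v c)) (n c) ((s c).1.headD []) (s c).2 :=
    best_polyTime hv hn (by fun_prop) (by fun_prop)
  have hm : PolyTime fun c => (s c).2.map fun e =>
      bif listEq e.1 ((best (conflict (v c)) (n c) ((s c).1.headD []) (s c).2).headD ([], [])).1
      then (e.1, (s c).1.headD [] :: e.2) else e := by
    have hb' : PolyTime fun x : γ × (Name × List Name) =>
        best (conflict (v x.1)) (n x.1) ((s x.1).1.headD []) (s x.1).2 := hb.comp fst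
    exact map (F := fun c e => bif listEq e.1
      ((best (conflict (v c)) (n c) ((s c).1.headD []) (s c).2).headD ([], [])).1
      then (e.1, (s c).1.headD [] :: e.2) else e) (l := fun c => (s c).2) (by fun_prop) (by fun_prop)
  unfold bid
  fun_prop

/-- The state of the auction after `i` steps. -/
def auction (R : Name → Name → Bool) (L : List Name) (i : ℕ) :
    List Name × List (Name × List Name) :=
  (bid R L.length)^[i] (L, L.map fun y => (y, []))

/-- Whether `m` is at most the number with the given binary digits, the lowest one first. -/
def leBits (m : ℕ) (l : List Bool) : Bool :=
  -- For a lowest digit `b`, `m ≤ b + 2 * u` holds iff `⌈(m - b) / 2⌉ ≤ u`. The binary number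
  -- itself, possibly exponentially large, is never written in unary.
  l.foldl (fun u b => ((bif b then u - 1 else u) + 1) / 2) m == 0

@[fun_prop]
theorem leBits_polyTime {γ : Type} [Code γ] {m : γ → ℕ} {l : γ → List Bool} (hm : PolyTime m)
    (hl : PolyTime l) : PolyTime fun c => leBits (m c) (l c) := by
  refine beq_zero (foldl_of_add (F := fun _ u b => ((bif b then u - 1 else u) + 1) / 2)
    (by fun_prop) hl hm (fun _ => 2) (PolyBdd.const 2) fun c u b => ?_)
  cases b <;> simp only [cond_true, cond_false, size_nat] <;> omega

/-! ## Analysis of the auction -/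

section Auction

variable {R : Name → Name → Bool} {n : ℕ}

theorem best_spec (x : Name) (t : List (Name × List Name)) :
    (best R n x t = [] ∧ ∀ e ∈ t, R x e.1 = true → n < e.2.length) ∨
    ∃ e ∈ t, best R n x t = [e] ∧ R x e.1 = true ∧ e.2.length ≤ n ∧
      ∀ e' ∈ t, R x e'.1 = true → e.2.length ≤ e'.2.length := by
  induction t with
  | nil => exact .inl ⟨rfl, by simp⟩
  | cons a t ih =>
    have hb : best R n x (a :: t) = bif R x a.1 && Nat.ble a.2.length n && ((best R n x t).isEmpty ||
      Nat.ble a.2.length ((best R n x t).headD ([], [])).2.length) then [a] else best R n x t := rfl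
    have hble : ∀ i j, Nat.ble i j = decide (i ≤ j) := fun i j => by
      rw [Bool.eq_iff_iff]
      simp
    rw [hb, hble, hble]
    rcases ih with ⟨h₁, h₂⟩ | ⟨e, he, h₁, h₂, h₃, h₄⟩
    · rw [h₁]
      by_cases hR : R x a.1 = true
      · by_cases hn : a.2.length ≤ n
        · refine .inr ⟨a, by simp, by simp [hR, hn], hR, hn, ?_⟩
          intro e' he' hR'
          rcases List.mem_cons.1 he' with rfl | he'
          · rfl
          · exact hn.trans (h₂ e' he' hR').le
        · refine .inl ⟨by simp [hn], ?_⟩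
          intro e' he' hR'
          rcases List.mem_cons.1 he' with rfl | he'
          · omega
          · exact h₂ e' he' hR'
      · refine .inl ⟨by simp [hR], ?_⟩
        intro e' he' hR'
        rcases List.mem_cons.1 he' with rfl | he'
        · exact absurd hR' hR
        · exact h₂ e' he' hR'
    · rw [h₁]
      by_cases hR : R x a.1 = true ∧ a.2.length ≤ e.2.length
      · refine .inr ⟨a, by simp, ?_, hR.1, by omega, ?_⟩
        · have : a.2.length ≤ n := by omega
          simp [hR.1, hR.2, this]
        · intro e' he' hR'
          rcases List.mem_cons.1 he' with rfl | he'
          · rfl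
          · exact hR.2.trans (h₄ e' he' hR')
      · refine .inr ⟨e, by simp [he], ?_, h₂, h₃, ?_⟩
        · rw [not_and] at hR
          by_cases h : R x a.1 = true
          · have := hR h
            simp [this]
          · simp [h]
        · intro e' he' hR'
          rcases List.mem_cons.1 he' with rfl | he'
          · by_contra h
            exact hR ⟨hR', by omega⟩
          · exact h₄ e' he' hR'

/-- The table with the list `h y` for every item `y`. -/
def table (L : List Name) (h : Name → List Name) : List (Name × List Name) :=
  L.map fun y => (y, h y)

theorem bid_nil (t : List (Name × List Name)) : bid R n ([], t) = ([], t) := rfl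

theorem bid_cons (L : List Name) (h : Name → List Name) (x : Name) (w : List Name) :
    (bid R n (x :: w, table L h) = (w, table L h) ∧ ∀ y ∈ L, R x y = true → n < (h y).length) ∨
    ∃ y ∈ L, R x y = true ∧ (h y).length ≤ n ∧
      (∀ y' ∈ L, R x y' = true → (h y).length ≤ (h y').length) ∧
      bid R n (x :: w, table L h) = ((h y).head?.toList ++ w,
        table L (Function.update h y (x :: h y))) := by
  rcases best_spec (R := R) (n := n) x (table L h) with ⟨h₁, h₂⟩ | ⟨e, he, h₁, h₂, h₃, h₄⟩
  · refine .inl ⟨by simp [bid, h₁], fun y hy hR => ?_⟩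
    exact h₂ (y, h y) (List.mem_map.2 ⟨y, hy, rfl⟩) hR
  · obtain ⟨y, hy, rfl⟩ := List.mem_map.1 he
    refine .inr ⟨y, hy, h₂, h₃, fun y' hy' hR => ?_, ?_⟩
    · exact h₄ (y', h y') (List.mem_map.2 ⟨y', hy', rfl⟩) hR
    · simp only [bid, List.isEmpty_cons, cond_false, List.headD_cons, h₁, List.tail_cons]
      congr 1
      · cases h y <;> simp
      · simp only [table, List.map_map]
        refine List.map_congr_left fun y' _ => ?_
        by_cases hyy : y' = y
        · subst hyy
          simp [(listEq_iff y' y').2 rfl]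
        · have : listEq y' y = false := by
            rw [← Bool.not_eq_true, listEq_iff]
            exact hyy
          simp [this, hyy]

/-- What holds for the sizes during the auction. -/
structure SizeInv (L : List Name) (w : List Name) (h : Name → List Name) : Prop where
  length_le : w.length ≤ L.length
  mem : ∀ x ∈ w, x ∈ L
  length_le' : ∀ y ∈ L, (h y).length ≤ L.length + 1
  mem' : ∀ y ∈ L, ∀ x ∈ h y, x ∈ L

/-- An item changes hands only while it has had at most `L.length` owners, and a bidder who takes an
item is replaced by at most one former owner. Nothing is assumed of `L` or `R`, because the running
time must be bounded on all inputs, also on those that encode no election. -/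
theorem auction_sizeInv (L : List Name) (i : ℕ) :
    ∃ w h, auction R L i = (w, table L h) ∧ SizeInv L w h := by
  induction i with
  | zero => exact ⟨L, fun _ => [], rfl, ⟨le_rfl, fun _ => _root_.id, by simp, by simp⟩⟩
  | succ i ih =>
    obtain ⟨w, h, e, hI⟩ := ih
    have e' : auction R L (i + 1) = bid R L.length (w, table L h) := by
      rw [← e, auction, Function.iterate_succ_apply', auction]
    rw [e']
    cases w with
    | nil => exact ⟨_, _, bid_nil _, hI⟩
    | cons x w =>
      have hw := hI.length_le
      simp only [List.length_cons] at hw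
      rcases bid_cons (R := R) (n := L.length) L h x w with ⟨h₁, -⟩ | ⟨y, hy, -, hn, -, h₁⟩
      · exact ⟨w, h, h₁, ⟨by omega, fun z hz => hI.mem z (by simp [hz]), hI.length_le', hI.mem'⟩⟩
      · refine ⟨_, _, h₁, ⟨?_, ?_, ?_, ?_⟩⟩
        · have : (h y).head?.toList.length ≤ 1 := by cases h y <;> simp
          rw [List.length_append]
          omega
        · intro z hz
          rcases List.mem_append.1 hz with hz | hz
          · refine hI.mem' y hy z ?_
            cases h' : h y <;> simp_all
          · exact hI.mem z (by simp [hz])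
        · intro y' hy'
          by_cases hyy : y' = y
          · subst hyy
            simpa using hn
          · simpa [hyy] using hI.length_le' y' hy'
        · intro y' hy' z hz
          by_cases hyy : y' = y
          · subst hyy
            rw [Function.update_self, List.mem_cons] at hz
            rcases hz with rfl | hz
            · exact hI.mem z (by simp)
            · exact hI.mem' y' hy' z hz
          · rw [Function.update_of_ne hyy] at hz
            exact hI.mem' y' hy' z hz

theorem size_auction_le (L : List Name) (i : ℕ) :
    size (auction R L i) ≤ (size L * (size L + 1) + 1) +
      (size L * ((size L + ((size L + 1) * (size L + 1) + 1) + 1) + 1) + 1) + 1 := by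
  obtain ⟨w, h, e, hI⟩ := auction_sizeInv (R := R) L i
  have hL := length_le_size L
  have hmul : ∀ (l : List Name) (N : ℕ), l.length ≤ N → (∀ x ∈ l, x ∈ L) →
      size l ≤ N * (size L + 1) + 1 := fun l N hl hx =>
    (size_le_mul l (size L) fun x h => size_le_of_mem (hx x h)).trans
      (Nat.add_le_add_right (Nat.mul_le_mul_right _ hl) 1)
  have h₁ := hmul w (size L) (hI.length_le.trans hL) hI.mem
  have h₂ : size (table L h) ≤
      size L * ((size L + ((size L + 1) * (size L + 1) + 1) + 1) + 1) + 1 := by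
    refine (size_le_mul _ (size L + ((size L + 1) * (size L + 1) + 1) + 1) ?_).trans
      (Nat.add_le_add_right (Nat.mul_le_mul_right _ (by simpa [table] using hL)) 1)
    intro a ha
    obtain ⟨y, hy, rfl⟩ := List.mem_map.1 ha
    have h₃ := size_le_of_mem hy
    have h₄ := hmul (h y) (size L + 1) ((hI.length_le' y hy).trans (by omega)) (hI.mem' y hy)
    rw [size_prod]
    dsimp only
    omega
  rw [e, size_prod]
  dsimp only
  omega

/-- The number of items that are owned after `n * (n + 2)` steps of the auction. -/
def matchNumber (R : Name → Name → Bool) (L : List Name) : ℕ :=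
  ((auction R L (L.length * (L.length + 2))).2.filter fun e => !e.2.isEmpty).length

theorem matchNumber_polyTime {γ : Type} [Code γ] {v : γ → List Name × List Name × List Name}
    {L : γ → List Name} (hv : PolyTime v) (hL : PolyTime L) :
    PolyTime fun c => matchNumber (conflict (v c)) (L c) := by
  -- Only the length `n * (n + 2)` of this list matters: folding over it iterates the auction that
  -- often.
  have hfuel : PolyTime fun c => (L c).flatMap fun _ => [] :: [] :: L c :=
    flatMap (F := fun c _ => [] :: [] :: L c) (by fun_prop) hL
  have hinit : PolyTime fun c => (L c).map fun y => ((y, []) : Name × List Name) :=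
    map (F := fun _ y => (y, [])) (by fun_prop) hL
  have hfold : ∀ (c : γ) (l : List Name), l.foldl
      (fun s _ => bid (conflict (v c)) (L c).length s) (L c, (L c).map fun y => (y, [])) =
      auction (conflict (v c)) (L c) l.length := by
    intro c l
    rw [List.foldl_const]
    rfl
  have hrun : PolyTime fun c => ((L c).flatMap fun _ => [] :: [] :: L c).foldl
      (fun s _ => bid (conflict (v c)) (L c).length s) (L c, (L c).map fun y => (y, [])) := by
    refine foldl (F := fun c s _ => bid (conflict (v c)) (L c).length s)
      (bid_polyTime (by fun_prop) (by fun_prop) (by fun_prop)) hfuel (by fun_prop)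
      (fun c => (size (L c) * (size (L c) + 1) + 1) + (size (L c) * ((size (L c) +
        ((size (L c) + 1) * (size (L c) + 1) + 1) + 1) + 1) + 1) + 1) ?_ fun c i => ?_
    · have hs := hL.size_bdd
      have h1 : PolyBdd fun _ : γ => 1 := PolyBdd.const 1
      exact (((hs.mul (hs.add h1)).add h1).add ((hs.mul (((hs.add
        (((hs.add h1).mul (hs.add h1)).add h1)).add h1).add h1)).add h1)).add h1
    · rw [hfold]
      exact size_auction_le _ _
  have : PolyTime fun c => ((((L c).flatMap fun _ => [] :: [] :: L c).foldl
      (fun s _ => bid (conflict (v c)) (L c).length s) (L c, (L c).map fun y => (y, []))).2.filter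
      fun e => !e.2.isEmpty).length :=
    length (filter (F := fun _ (e : Name × List Name) => !e.2.isEmpty) (by fun_prop)
      (snd.comp hrun))
  convert this using 2 with c
  rw [hfold]
  simp [matchNumber, List.length_flatMap]

end Auction

/-! ## Antichains and matchings -/

section Antichain

variable {α : Type} [DecidableEq α] {R : α → α → Prop} {L S : Finset α} {o : α → α}

/-- A matching bounds the size of the antichains. -/
theorem card_antichain_add_le (htrans : ∀ a b c, R a b → R b c → R a c) (hS : S ⊆ L)
    (ho : ∀ y ∈ S, o y ∈ L) (hinj : Set.InjOn o S) (hR : ∀ y ∈ S, R (o y) y) {X : Finset α}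
    (hX : X ⊆ L) (hanti : ∀ a ∈ X, ∀ b ∈ X, ¬ R a b) : X.card + S.card ≤ L.card := by
  classical
  have h : S.card ≤ (L \ X).card := by
    -- From each matched pair one element outside `X` is chosen. If `o y` is below a member of `X`,
    -- it is not in `X`; otherwise `y` is not in `X`, since `y` is above `o y`.
    refine Finset.card_le_card_of_injOn (fun y => if ∃ a ∈ X, R (o y) a then o y else y) ?_ ?_
    · intro y hy
      have hy : y ∈ S := hy
      simp only [Finset.coe_sdiff, Set.mem_sdiff, Finset.mem_coe]
      split_ifs with h
      · obtain ⟨a, ha, h⟩ := h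
        exact ⟨ho y hy, fun h' => hanti _ h' a ha h⟩
      · exact ⟨hS hy, fun h' => h ⟨y, h', hR y hy⟩⟩
    · intro y hy y' hy' e
      have hy : y ∈ S := hy
      have hy' : y' ∈ S := hy'
      simp only at e
      split_ifs at e with h h' h'
      · exact hinj hy hy' e
      -- In a mixed collision `o y = y'`, and `R (o y') y'` with `R y' a` gives `R (o y') a`,
      -- against the choice made for `y'`.
      · obtain ⟨a, ha, h⟩ := h
        exact absurd ⟨a, ha, htrans _ _ _ (by simpa [e] using hR y' hy') h⟩ h'
      · obtain ⟨a, ha, h'⟩ := h'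
        exact absurd ⟨a, ha, htrans _ _ _ (by simpa [← e] using hR y hy) h'⟩ h
      · exact e
  rw [Finset.card_sdiff_of_subset hX] at h
  have := Finset.card_le_card hX
  omega

/-- The prices at the end of an auction yield a large antichain. -/
theorem exists_antichain (p : α → ℕ) (hS : ∀ y, y ∈ S ↔ y ∈ L ∧ 0 < p y)
    (h : ∀ x ∈ L, (∃ y ∈ S, o y = x ∧ ∀ y' ∈ L, R x y' → p y ≤ p y' + 1) ∨
      ∀ y ∈ L, R x y → L.card < p y) :
    ∃ X ⊆ L, (∀ a ∈ X, ∀ b ∈ X, ¬ R a b) ∧ L.card ≤ X.card + S.card := by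
  classical
  -- There are `L.card + 1` levels and at most `L.card` prices, so some level is not a price.
  obtain ⟨l, hl, hlp⟩ : ∃ l ∈ Finset.Icc 1 (L.card + 1), l ∉ L.image p := by
    refine Finset.exists_mem_notMem_of_card_lt_card ?_
    have : (L.image p).card ≤ L.card := Finset.card_image_le
    simp
    omega
  have hne : ∀ y ∈ L, p y ≠ l := fun y hy e => hlp (Finset.mem_image.2 ⟨y, hy, e⟩)
  rw [Finset.mem_Icc] at hl
  -- Owners of the items priced below `l` and the owned items priced above it: a vertex cover with
  -- at most one vertex per matched pair.
  let A := (S.filter fun y => p y < l).image o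
  let B := S.filter fun y => ¬ p y < l
  refine ⟨L \ (A ∪ B), Finset.sdiff_subset, ?_, ?_⟩
  · intro a ha b hb hab
    simp only [Finset.mem_sdiff, Finset.mem_union, not_or] at ha hb
    obtain ⟨haL, haA, -⟩ := ha
    obtain ⟨hbL, -, hbB⟩ := hb
    have hpb : p b < l := by
      by_contra hpb
      exact hbB (Finset.mem_filter.2 ⟨(hS b).2 ⟨hbL, by omega⟩, hpb⟩)
    rcases h a haL with ⟨y, hy, e, hy'⟩ | h'
    -- The owner `a` of `y` has `p y ≤ p b + 1 ≤ l`, and `l` is not a price, so `p y < l` and `a` is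
    -- in `A`. A bidder without an item is excluded, as its eligible items cost more than `L.card`.
    · have h₁ := hy' b hbL hab
      have h₂ := hne y ((hS y).1 hy).1
      exact haA (Finset.mem_image.2 ⟨y, Finset.mem_filter.2 ⟨hy, by omega⟩, e⟩)
    · have := h' b hbL hab
      omega
  · have h₁ : (A ∪ B).card ≤ S.card := by
      refine (Finset.card_union_le _ _).trans ?_
      rw [← Finset.card_filter_add_card_filter_not (s := S) (fun y => p y < l)]
      exact Nat.add_le_add_right Finset.card_image_le _
    have h₂ := Finset.le_card_sdiff (A ∪ B) L
    omega

end Antichain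

/-! ## Correctness of the auction -/

section Auction

variable {R : Name → Name → Bool} {L : List Name}

/-- What holds for the owners and prices during the auction. -/
structure MatchInv (R : Name → Name → Bool) (L w : List Name) (h : Name → List Name) : Prop where
  nodup : w.Nodup
  mem : ∀ x ∈ w, x ∈ L
  owner_mem : ∀ y ∈ L, ∀ x, (h y).head? = some x → x ∈ L
  not_mem : ∀ y ∈ L, ∀ x, (h y).head? = some x → x ∉ w
  inj : ∀ y ∈ L, ∀ y' ∈ L, ∀ x, (h y).head? = some x → (h y').head? = some x → y = y'
  rel : ∀ y ∈ L, ∀ x, (h y).head? = some x → R x y = true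
  price : ∀ y ∈ L, ∀ x, (h y).head? = some x →
    ∀ y' ∈ L, R x y' = true → (h y).length ≤ (h y').length + 1
  cover : ∀ x ∈ L, x ∈ w ∨ (∃ y ∈ L, (h y).head? = some x) ∨
    ∀ y ∈ L, R x y = true → L.length < (h y).length

theorem MatchInv.drop {x : Name} {w : List Name} {h : Name → List Name}
    (hI : MatchInv R L (x :: w) h) (hx : ∀ y ∈ L, R x y = true → L.length < (h y).length) :
    MatchInv R L w h where
  nodup := (List.nodup_cons.1 hI.nodup).2
  mem z hz := hI.mem z (by simp [hz])
  owner_mem := hI.owner_mem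
  not_mem y hy z hz hzw := hI.not_mem y hy z hz (by simp [hzw])
  inj := hI.inj
  rel := hI.rel
  price := hI.price
  cover z hz := by
    rcases hI.cover z hz with h | h | h
    · rcases List.mem_cons.1 h with rfl | h
      · exact .inr (.inr hx)
      · exact .inl h
    · exact .inr (.inl h)
    · exact .inr (.inr h)

/-- The field `price` survives because `y` was a cheapest eligible item for `x`, its price rises by
one only, and no price ever falls. The field `cover` survives because the former owner of `y`
returns to the bidders. -/
theorem MatchInv.take {x y : Name} {w : List Name} {h : Name → List Name}
    (hI : MatchInv R L (x :: w) h) (hy : y ∈ L) (hR : R x y = true)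
    (hmin : ∀ y' ∈ L, R x y' = true → (h y).length ≤ (h y').length) :
    MatchInv R L ((h y).head?.toList ++ w) (Function.update h y (x :: h y)) := by
  have hxw := List.nodup_cons.1 hI.nodup
  have hup : ∀ y' z, (Function.update h y (x :: h y) y').head? = some z →
      (y' = y ∧ z = x) ∨ (y' ≠ y ∧ (h y').head? = some z) := by
    intro y' z hz
    by_cases e : y' = y
    · subst e
      simp only [Function.update_self, List.head?_cons, Option.some.injEq] at hz
      exact .inl ⟨rfl, hz.symm⟩
    · rw [Function.update_of_ne e] at hz
      exact .inr ⟨e, hz⟩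
  have hle : ∀ y', (h y').length ≤ (Function.update h y (x :: h y) y').length := by
    intro y'
    by_cases e : y' = y
    · subst e
      simp
    · rw [Function.update_of_ne e]
  have hw : ∀ z, z ∈ (h y).head?.toList ++ w ↔ (h y).head? = some z ∨ z ∈ w := by
    intro z
    simp
  refine ⟨?_, ?_, ?_, ?_, ?_, ?_, ?_, ?_⟩
  · cases e : (h y).head? with
    | none => exact hxw.2
    | some z =>
      refine List.nodup_cons.2 ⟨fun hz => ?_, hxw.2⟩
      exact hI.not_mem y hy z e (List.mem_cons_of_mem _ hz)
  · intro z hz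
    rcases (hw z).1 hz with hz | hz
    · exact hI.owner_mem y hy z hz
    · exact hI.mem z (by simp [hz])
  · intro y' hy' z hz
    rcases hup y' z hz with ⟨rfl, rfl⟩ | ⟨-, hz⟩
    · exact hI.mem z (by simp)
    · exact hI.owner_mem y' hy' z hz
  · intro y' hy' z hz hzw
    rw [hw] at hzw
    rcases hup y' z hz with ⟨rfl, rfl⟩ | ⟨hne, hz⟩
    · rcases hzw with hzw | hzw
      · exact hI.not_mem y' hy z hzw (by simp)
      · exact hxw.1 hzw
    · rcases hzw with hzw | hzw
      · exact hne (hI.inj y' hy' y hy z hz hzw)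
      · exact hI.not_mem y' hy' z hz (by simp [hzw])
  · intro y₁ hy₁ y₂ hy₂ z hz₁ hz₂
    rcases hup y₁ z hz₁ with ⟨e₁, e₁'⟩ | ⟨hne₁, hh₁⟩ <;>
      rcases hup y₂ z hz₂ with ⟨e, e'⟩ | ⟨hne₂, hh₂⟩
    · exact e₁.trans e.symm
    · subst e₁'
      exact absurd (by simp) (hI.not_mem y₂ hy₂ z hh₂)
    · subst e'
      exact absurd (by simp) (hI.not_mem y₁ hy₁ z hh₁)
    · exact hI.inj y₁ hy₁ y₂ hy₂ z hh₁ hh₂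
  · intro y' hy' z hz
    rcases hup y' z hz with ⟨rfl, rfl⟩ | ⟨-, hz⟩
    · exact hR
    · exact hI.rel y' hy' z hz
  · intro y₁ hy₁ z hz y₂ hy₂ hR'
    have h₁ := hle y₂
    rcases hup y₁ z hz with ⟨rfl, rfl⟩ | ⟨hne, hz⟩
    · have := hmin y₂ hy₂ hR'
      simp only [Function.update_self, List.length_cons]
      omega
    · have := hI.price y₁ hy₁ z hz y₂ hy₂ hR'
      rw [Function.update_of_ne hne]
      omega
  · intro z hz
    rw [hw]
    rcases hI.cover z hz with h' | ⟨y', hy', h'⟩ | h'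
    · rcases List.mem_cons.1 h' with rfl | h'
      · exact .inr (.inl ⟨y, hy, by simp⟩)
      · exact .inl (.inr h')
    · by_cases e : y' = y
      · subst e
        exact .inl (.inl h')
      · exact .inr (.inl ⟨y', hy', by rwa [Function.update_of_ne e]⟩)
    · exact .inr (.inr fun y' hy' hR' => (h' y' hy' hR').trans_le (hle y'))

/-- The potential is the number of bidders plus the sum of the amounts by which prices lie below `n
+ 1`. It starts at `n + n * (n + 1)`. A departure removes a bidder; a purchase does not increase the
number of bidders and raises a price that is at most `n`. So each step lowers the potential, and the
auction ends within `n * (n + 2)` steps. -/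
theorem auction_matchInv (hL : L.Nodup) (i : ℕ) :
    ∃ w h, auction R L i = (w, table L h) ∧ MatchInv R L w h ∧
      (w = [] ∨ w.length + ∑ y ∈ L.toFinset, (L.length + 1 - (h y).length) + i ≤
        L.length * (L.length + 2)) := by
  induction i with
  | zero =>
    refine ⟨L, fun _ => [], rfl, ⟨hL, fun _ => id, by simp, by simp, by simp, by simp, by simp,
      fun x hx => .inl hx⟩, .inr ?_⟩
    simp only [List.length_nil, Nat.sub_zero, Finset.sum_const, smul_eq_mul,
      List.toFinset_card_of_nodup hL]
    apply le_of_eq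
    ring
  | succ i ih =>
    obtain ⟨w, h, e, hI, hpot⟩ := ih
    have e' : auction R L (i + 1) = bid R L.length (w, table L h) := by
      rw [← e, auction, Function.iterate_succ_apply', auction]
    rw [e']
    cases w with
    | nil => exact ⟨_, _, bid_nil _, hI, .inl rfl⟩
    | cons x w =>
      rcases hpot with hpot | hpot
      · simp at hpot
      simp only [List.length_cons] at hpot
      rcases bid_cons (R := R) (n := L.length) L h x w with ⟨h₁, h₂⟩ | ⟨y, hy, hR, hn, hmin, h₁⟩
      · exact ⟨w, h, h₁, hI.drop h₂, .inr (by omega)⟩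
      · refine ⟨_, _, h₁, hI.take hy hR hmin, .inr ?_⟩
        have h₂ : (h y).head?.toList.length ≤ 1 := by cases h y <;> simp
        have h₃ : ∑ y' ∈ L.toFinset, (L.length + 1 - (Function.update h y (x :: h y) y').length) <
            ∑ y' ∈ L.toFinset, (L.length + 1 - (h y').length) := by
          refine Finset.sum_lt_sum (fun y' _ => ?_) ⟨y, by simpa using hy, ?_⟩
          · by_cases hyy : y' = y
            · subst hyy
              simp only [Function.update_self, List.length_cons]
              omega
            · rw [Function.update_of_ne hyy]
          · simp only [Function.update_self, List.length_cons]
            omega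
        rw [List.length_append]
        omega

/-- Once no bidder is waiting, `MatchInv` provides both certificates: `inj` and `rel` make the
owners a matching, while `price` and `cover` are the hypotheses of `exists_antichain`. -/
theorem matchNumber_spec (hL : L.Nodup)
    (htrans : ∀ a b c, R a b = true → R b c = true → R a c = true) :
    (∃ X ⊆ L.toFinset, (∀ a ∈ X, ∀ b ∈ X, ¬ R a b = true) ∧
      L.length ≤ X.card + matchNumber R L) ∧
    ∀ X ⊆ L.toFinset, (∀ a ∈ X, ∀ b ∈ X, ¬ R a b = true) →
      X.card + matchNumber R L ≤ L.length := by
  obtain ⟨w, h, e, hI, hpot⟩ := auction_matchInv (R := R) hL (L.length * (L.length + 2))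
  have hw : w = [] := by
    rcases hpot with hw | hpot
    · exact hw
    · exact List.length_eq_zero_iff.1 (by omega)
  subst hw
  set S := L.toFinset.filter fun y => 0 < (h y).length with hSdef
  have hS : ∀ y, y ∈ S ↔ y ∈ L.toFinset ∧ 0 < (h y).length := fun y => by simp [S]
  have hnum : matchNumber R L = S.card := by
    rw [matchNumber, e, table, List.filter_map, List.length_map,
      ← List.toFinset_card_of_nodup (hL.filter _), List.toFinset_filter]
    congr 1
    refine Finset.filter_congr fun y _ => ?_
    cases e' : h y <;> simp [e']
  have hcard := List.toFinset_card_of_nodup hL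
  have hhead : ∀ y ∈ S, (h y).head? = some ((h y).headD []) := by
    intro y hy
    have := ((hS y).1 hy).2
    cases e' : h y with
    | nil => simp [e'] at this
    | cons a l => rfl
  have hSL : ∀ y ∈ S, y ∈ L := fun y hy => by simpa using ((hS y).1 hy).1
  rw [hnum, ← hcard]
  refine ⟨?_, fun X hX hanti => ?_⟩
  · refine exists_antichain (o := fun y => (h y).headD []) (fun y => (h y).length) hS ?_
    intro x hx
    rcases hI.cover x (by simpa using hx) with h' | ⟨y, hy, h'⟩ | h'
    · simp at h'
    · have hyS : y ∈ S := by
        rw [hS]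
        refine ⟨by simpa using hy, ?_⟩
        cases e' : h y with
        | nil => simp [e'] at h'
        | cons a l => simp
      refine .inl ⟨y, hyS, ?_, fun y' hy' hR => ?_⟩
      · have := hhead y hyS
        rw [h'] at this
        exact (Option.some.inj this).symm
      · exact hI.price y hy x h' y' (by simpa using hy') hR
    · refine .inr fun y hy hR => ?_
      rw [hcard]
      exact h' y (by simpa using hy) hR
  · refine card_antichain_add_le (o := fun y => (h y).headD []) htrans (Finset.filter_subset _ _)
      ?_ ?_ ?_ hX hanti
    · intro y hy
      simpa using hI.owner_mem y (hSL y hy) _ (hhead y hy)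
    · intro y hy y' hy' he
      refine hI.inj y (hSL y hy) y' (hSL y' hy') _ (hhead y hy) ?_
      have he : (h y).headD [] = (h y').headD [] := he
      rw [he]
      exact hhead y' hy'
    · intro y hy
      exact hI.rel y (hSL y hy) _ (hhead y hy)

/-! ## Chains -/

theorem mem_strip {l : List Name} {y : Name} :
    y ∈ strip R l ↔ y ∈ l ∧ ∃ x ∈ l, R x y = true := by
  simp [strip]

/-- An order is partitioned into `k` antichains iff nothing is left after removing the minimal
elements `k` times. -/
theorem strip_iterate_eq_nil_iff (k : ℕ)
    (htrans : ∀ a b c, R a b = true → R b c = true → R a c = true) :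
    (strip R)^[k] L = [] ↔
      ∃ c : Name → ℕ, ∀ a ∈ L, c a < k ∧ ∀ b ∈ L, c a = c b → ¬ R a b = true := by
  have hsucc : ∀ i, (strip R)^[i + 1] L = strip R ((strip R)^[i] L) := fun i =>
    Function.iterate_succ_apply' ..
  have hanti : ∀ i j, i ≤ j → ∀ a ∈ (strip R)^[j] L, a ∈ (strip R)^[i] L := by
    intro i j hij
    induction hij with
    | refl => exact fun _ => id
    | step _ ih =>
      intro a ha
      rw [Nat.succ_eq_add_one, hsucc, mem_strip] at ha
      exact ih a ha.1
  constructor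
  · intro hk
    classical
    -- The colour of a name is the last round that it survives. If `a` is below `b` and both survive
    -- round `i`, then `b` is not minimal and survives round `i + 1`, so their colours differ.
    refine ⟨fun a => Nat.findGreatest (fun i => a ∈ (strip R)^[i] L) k, fun a ha => ⟨?_, ?_⟩⟩
    · refine lt_of_le_of_ne (Nat.findGreatest_le k) fun e => ?_
      have := Nat.findGreatest_spec (P := fun i => a ∈ (strip R)^[i] L) (n := k)
        (Nat.zero_le _) ha
      beta_reduce at e
      rw [e, hk] at this
      simp at this
    · intro b hb e hR
      have h₁ := Nat.findGreatest_spec (P := fun i => a ∈ (strip R)^[i] L) (n := k)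
        (Nat.zero_le _) ha
      have h₂ := Nat.findGreatest_spec (P := fun i => b ∈ (strip R)^[i] L) (n := k)
        (Nat.zero_le _) hb
      simp only at e
      rw [e] at h₁
      set i := Nat.findGreatest (fun i => b ∈ (strip R)^[i] L) k with hi
      have h₃ : b ∈ (strip R)^[i + 1] L := by
        rw [hsucc, mem_strip]
        exact ⟨h₂, a, h₁, hR⟩
      have h₄ : i + 1 ≤ k := by
        by_contra h
        have : i = k := le_antisymm (Nat.findGreatest_le k) (by omega)
        rw [this, hk] at h₂
        simp at h₂
      have := Nat.le_findGreatest (P := fun i => b ∈ (strip R)^[i] L) h₄ h₃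
      omega
  · rintro ⟨c, hc⟩
    -- A name that survives `i` rounds is the top of a chain with `i` names below it, and comparable
    -- names have different colours.
    have key : ∀ i, ∀ y ∈ (strip R)^[i] L, ∃ T : Finset Name, T.card = i ∧
        (∀ t ∈ T, t ∈ L ∧ R t y = true) ∧ Set.InjOn c T := by
      intro i
      induction i with
      | zero => exact fun y _ => ⟨∅, by simp⟩
      | succ i ih =>
        intro y hy
        rw [hsucc, mem_strip] at hy
        obtain ⟨hy, x, hx, hR⟩ := hy
        obtain ⟨T, hT₁, hT₂, hT₃⟩ := ih x hx
        have hxL : x ∈ L := hanti 0 i (Nat.zero_le _) x hx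
        have hne : ∀ t ∈ T, c t ≠ c x := fun t ht e =>
          (hc t (hT₂ t ht).1).2 x hxL e (hT₂ t ht).2
        have hxT : x ∉ T := fun h => hne x h rfl
        refine ⟨insert x T, by rw [Finset.card_insert_of_notMem hxT, hT₁], ?_, ?_⟩
        · intro t ht
          rcases Finset.mem_insert.1 ht with rfl | ht
          · exact ⟨hxL, hR⟩
          · exact ⟨(hT₂ t ht).1, htrans _ _ _ (hT₂ t ht).2 hR⟩
        · rw [Finset.coe_insert, Set.injOn_insert (by simpa using hxT)]
          refine ⟨hT₃, ?_⟩
          rintro ⟨t, ht, e⟩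
          exact hne t ht e
    rw [List.eq_nil_iff_forall_not_mem]
    intro y hy
    obtain ⟨T, hT₁, hT₂, hT₃⟩ := key k y hy
    have hyL : y ∈ L := hanti 0 k (Nat.zero_le _) y hy
    -- The `k` names below a survivor `y` would need `k` distinct colours, all different from that
    -- of `y`.
    have hlt : T.card ≤ ((Finset.range k).erase (c y)).card := by
      refine Finset.card_le_card_of_injOn c (fun t ht => ?_) hT₃
      have := hT₂ t ht
      simp only [Finset.coe_erase, Finset.coe_range, Set.mem_sdiff, Set.mem_Iio,
        Set.mem_singleton_iff]
      exact ⟨(hc t this.1).1, fun e => (hc t this.1).2 y hyL e this.2⟩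
    rw [Finset.card_erase_of_mem (by simpa using (hc y hyL).1), Finset.card_range, hT₁] at hlt
    have := (hc y hyL).1
    omega

end Auction

/-! ## Binary numbers -/

/-- The number with given binary digits, the lowest one first. -/
def bitsVal : List Bool → ℕ
  | [] => 0
  | b :: l => b.toNat + 2 * bitsVal l

theorem leBits_iff (m : ℕ) (l : List Bool) : leBits m l = true ↔ m ≤ bitsVal l := by
  rw [leBits, beq_iff_eq]
  induction l generalizing m with
  | nil => simp [bitsVal]
  | cons b l ih =>
    rw [List.foldl_cons, ih, bitsVal]
    cases b <;> simp <;> omega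

theorem bitsVal_encodeNat (n : ℕ) : bitsVal (Computability.encodeNat n) = n := by
  have hpos : ∀ p : PosNum, bitsVal (Computability.encodePosNum p) = p := by
    intro p
    induction p with
    | one => rfl
    | bit1 p ih => simp [Computability.encodePosNum, bitsVal, ih]; omega
    | bit0 p ih => simp [Computability.encodePosNum, bitsVal, ih]; omega
  rw [Computability.encodeNat]
  conv_rhs => rw [← Num.to_of_nat n]
  cases (n : Num) with
  | zero => rfl
  | pos p => exact hpos p

/-! ## Single-crossing elections with at most three voters -/

/-- The voters who agree with the first one are all voters or the first alone, and both sets are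
initial segments. -/
theorem isSingleCrossing_of_le_two {C : Type} (E : Election C) (h : E.numVoters ≤ 2) :
    E.IsSingleCrossing := by
  classical
  obtain ⟨n, vote⟩ := E
  intro h₀ a b hab
  have hn : n ≤ 2 := h
  have h₀ : 0 < n := h₀
  by_cases hall : ∀ i : Fin n, Election.Prefers ⟨n, vote⟩ i a b
  · exact ⟨n, h₀, le_rfl, Set.ext fun i => ⟨fun _ => i.2, fun _ => hall i⟩⟩
  · refine ⟨1, le_rfl, h₀, Set.ext fun i => ⟨fun hi => ?_, fun hi => ?_⟩⟩
    · by_contra hi'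
      refine hall fun j => ?_
      have hi' : ¬ (i : ℕ) < 1 := hi'
      rcases Nat.eq_zero_or_pos j.val with hj | hj
      · rw [show j = ⟨0, h₀⟩ from Fin.ext hj]
        exact hab
      · rw [show j = i from Fin.ext (by omega)]
        exact hi
    · have hi : (i : ℕ) < 1 := hi
      have : i = ⟨0, h₀⟩ := Fin.ext (by simpa using hi)
      subst this
      exact hab

/-- Among the sets of voters that contain voter 0, only `{0, 2}` is not an initial segment. -/
theorem isSingleCrossing_three_iff {C : Type} (vote : Fin 3 → LinearOrder C) :
    (⟨3, vote⟩ : Election C).IsSingleCrossing ↔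
      ∀ a b, ¬ ((vote 0).lt a b ∧ (vote 2).lt a b ∧ (vote 1).lt b a) := by
  constructor
  · rintro h a b ⟨h₀, h₂, h₁⟩
    obtain ⟨t, -, -, ht⟩ := h (show 0 < 3 by decide) a b h₀
    have e₂ : (2 : Fin 3) ∈ {i : Fin 3 | (i : ℕ) < t} := ht ▸ h₂
    have e₂ : 2 < t := e₂
    have e₁ : (1 : Fin 3) ∈ {i : Fin 3 | Election.Prefers ⟨3, vote⟩ i a b} := by
      rw [ht]
      show 1 < t
      omega
    exact @lt_asymm C (vote 1).toPreorder _ _ h₁ e₁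
  · intro h h₀ a b hab
    have hab : (vote 0).lt a b := hab
    have hne : b ≠ a := fun e => @lt_irrefl C (vote 0).toPreorder a (e ▸ hab)
    by_cases h₁ : (vote 1).lt a b
    · by_cases h₂ : (vote 2).lt a b
      · refine ⟨3, by decide, le_rfl, Set.ext fun i => ⟨fun _ => i.2, fun _ => ?_⟩⟩
        fin_cases i
        exacts [hab, h₁, h₂]
      · refine ⟨2, by decide, show 2 ≤ 3 by decide, Set.ext fun i => ?_⟩
        fin_cases i
        exacts [⟨fun _ => (by decide : 0 < 2), fun _ => hab⟩,
          ⟨fun _ => (by decide : 1 < 2), fun _ => h₁⟩,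
          ⟨fun h => absurd h h₂, fun h => absurd h (by decide : ¬ 2 < 2)⟩]
    · have h₂ : ¬ (vote 2).lt a b := fun h₂ => h a b ⟨hab, h₂, by
        rcases @lt_trichotomy C (vote 1) a b with h' | h' | h'
        · exact absurd h' h₁
        · exact absurd h'.symm hne
        · exact h'⟩
      refine ⟨1, by decide, show 1 ≤ 3 by decide, Set.ext fun i => ?_⟩
      fin_cases i
      exacts [⟨fun _ => (by decide : 0 < 1), fun _ => hab⟩,
        ⟨fun h => absurd h h₁, fun h => absurd h (by decide : ¬ 1 < 1)⟩,
        ⟨fun h => absurd h h₂, fun h => absurd h (by decide : ¬ 2 < 1)⟩]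

/-! ## Names -/

/-- The name of a candidate. -/
def name {m : ℕ} (a : Fin m) : Name := encodeNat a.val

theorem name_injective {m : ℕ} : Function.Injective (name : Fin m → Name) := fun _ _ h =>
  Fin.ext (encodingNatBool.encode_injective h)

/-- A vote, as a list of names. -/
def nameList {m : ℕ} (E : Election (Fin m)) (i : Fin E.numVoters) : List Name :=
  (E.ranking i).map name

theorem before_cons (l : List Name) (c a b : Name) : before (c :: l) a b =
    bif listEq c b then false else bif listEq c a then true else before l a b := rfl

theorem listEq_self (a : Name) : listEq a a = true := (listEq_iff a a).2 rfl

theorem listEq_of_ne {a b : Name} (h : a ≠ b) : listEq a b = false := by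
  rw [← Bool.not_eq_true, listEq_iff]
  exact h

theorem before_trans (l : List Name) (a b c : Name) (h : before l a b = true)
    (h' : before l b c = true) : before l a c = true := by
  induction l with
  | nil => simp [before] at h
  | cons d l ih =>
    rw [before_cons] at h h' ⊢
    by_cases hc : d = c
    · subst hc
      simp [listEq_self] at h'
    · by_cases hb : d = b
      · subst hb
        simp [listEq_self] at h
      · by_cases ha : d = a
        · subst ha
          simp [listEq_self, listEq_of_ne hc]
        · simp only [listEq_of_ne ha, listEq_of_ne hb, listEq_of_ne hc, cond_false] at h h' ⊢
          exact ih h h'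

/-- The relation is the intersection of two orders and the reverse of a third. -/
theorem conflict_trans (v : List Name × List Name × List Name) (a b c : Name)
    (h : conflict v a b = true) (h' : conflict v b c = true) : conflict v a c = true := by
  simp only [conflict, Bool.and_eq_true] at h h' ⊢
  exact ⟨⟨before_trans _ _ _ _ h.1.1 h'.1.1, before_trans _ _ _ _ h.1.2 h'.1.2⟩,
    before_trans _ _ _ _ h'.2 h.2⟩

theorem before_map_name {m : ℕ} (r : Fin m → Fin m → Prop) (hasymm : ∀ a b, r a b → ¬ r b a)
    (l : List (Fin m)) (hl : l.Pairwise r) (a b : Fin m) (ha : a ∈ l) (hb : b ∈ l) :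
    before (l.map name) (name a) (name b) = true ↔ r a b := by
  induction l with
  | nil => simp at ha
  | cons c l ih =>
    rw [List.map_cons, before_cons]
    rw [List.pairwise_cons] at hl
    by_cases hcb : c = b
    · subst hcb
      simp only [listEq_self, cond_true, Bool.false_eq_true, false_iff]
      rcases List.mem_cons.1 ha with rfl | ha
      · exact fun h => hasymm _ _ h h
      · exact hasymm _ _ (hl.1 a ha)
    · rw [listEq_of_ne fun h => hcb (name_injective h), cond_false]
      have hb : b ∈ l := (List.mem_cons.1 hb).resolve_left fun h => hcb h.symm
      by_cases hca : c = a
      · subst hca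
        simp only [listEq_self, cond_true, true_iff]
        exact hl.1 b hb
      · rw [listEq_of_ne fun h => hca (name_injective h), cond_false]
        exact ih hl.2 ((List.mem_cons.1 ha).resolve_left fun h => hca h.symm) hb

theorem pairwise_sort_lt {C : Type} [LinearOrder C] (s : Finset C) :
    (s.sort fun a b : C => a ≤ b).Pairwise (· < ·) :=
  s.sortedLT_sort.pairwise

section nameList

variable {m : ℕ} (E : Election (Fin m)) (i : Fin E.numVoters)

theorem pairwise_ranking : (E.ranking i).Pairwise (E.vote i).lt :=
  @pairwise_sort_lt (Fin m) (E.vote i) Finset.univ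

theorem mem_ranking (a : Fin m) : a ∈ E.ranking i := by
  let := E.vote i
  exact (Finset.mem_sort _).2 (Finset.mem_univ a)

theorem nodup_ranking : (E.ranking i).Nodup := by
  let := E.vote i
  exact Finset.sort_nodup _ _

theorem length_nameList : (nameList E i).length = m := by
  let := E.vote i
  rw [nameList, List.length_map]
  exact (Finset.length_sort _).trans (Finset.card_fin m)

theorem nodup_nameList : (nameList E i).Nodup := (nodup_ranking E i).map name_injective

theorem mem_nameList {x : Name} : x ∈ nameList E i ↔ ∃ a : Fin m, name a = x := by
  simp [nameList, mem_ranking]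

theorem before_nameList (a b : Fin m) :
    before (nameList E i) (name a) (name b) = true ↔ (E.vote i).lt a b :=
  before_map_name _ (fun _ _ => @lt_asymm _ (E.vote i).toPreorder _ _) _ (pairwise_ranking E i) a b
    (mem_ranking E i a) (mem_ranking E i b)

end nameList

/-! ## The two problems for three voters -/

section Three

variable {m : ℕ} (vote : Fin 3 → LinearOrder (Fin m))

/-- The lists of names for three votes. -/
def votes : List Name × List Name × List Name :=
  (nameList ⟨3, vote⟩ (0 : Fin 3), nameList ⟨3, vote⟩ (1 : Fin 3), nameList ⟨3, vote⟩ (2 : Fin 3))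

/-- This turns both problems into questions about antichains of the conflict order. -/
theorem restrict_isSingleCrossing_iff (X : Finset (Fin m)) :
    ((⟨3, vote⟩ : Election (Fin m)).restrict X).IsSingleCrossing ↔
      ∀ a ∈ X, ∀ b ∈ X, ¬ conflict (votes vote) (name a) (name b) = true := by
  have h : ∀ a b, conflict (votes vote) (name a) (name b) = true ↔
      (vote 0).lt a b ∧ (vote 2).lt a b ∧ (vote 1).lt b a := by
    intro a b
    simp only [conflict, votes, Bool.and_eq_true, before_nameList]
    exact and_assoc
  simp only [h]
  refine (isSingleCrossing_three_iff _).trans ?_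
  exact ⟨fun h a ha b hb => h ⟨a, ha⟩ ⟨b, hb⟩, fun h a b => h a a.2 b b.2⟩

theorem candidateDeletion_iff (k : ℕ) : (⟨3, vote⟩ : Election (Fin m)).CandidateDeletion k ↔
    matchNumber (conflict (votes vote)) (votes vote).1 ≤ k := by
  classical
  have hlen : (votes vote).1.length = m := length_nameList _ _
  obtain ⟨⟨X, hX, hX', hcard⟩, hmax⟩ := matchNumber_spec (R := conflict (votes vote))
    (nodup_nameList ⟨3, vote⟩ (0 : Fin 3)) (conflict_trans _)
  have hsub : ∀ x ∈ X, ∃ a : Fin m, name a = x := fun x hx =>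
    (mem_nameList _ _).1 (List.mem_toFinset.1 (hX hx))
  constructor
  · rintro ⟨Y, hY, hsc⟩
    rw [restrict_isSingleCrossing_iff] at hsc
    have := hmax (Y.image name) (fun x hx => ?_) ?_
    · rw [Finset.card_image_of_injective _ name_injective, length_nameList] at this
      rw [Fintype.card_fin] at hY
      change Y.card + matchNumber (conflict (votes vote)) (votes vote).1 ≤ m at this
      omega
    · obtain ⟨a, -, rfl⟩ := Finset.mem_image.1 hx
      exact List.mem_toFinset.2 ((mem_nameList _ _).2 ⟨a, rfl⟩)
    · intro x hx y hy
      obtain ⟨a, ha, rfl⟩ := Finset.mem_image.1 hx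
      obtain ⟨b, hb, rfl⟩ := Finset.mem_image.1 hy
      exact hsc a ha b hb
  · intro hk
    refine ⟨Finset.univ.filter fun a => name a ∈ X, ?_, ?_⟩
    · have h : X ⊆ (Finset.univ.filter fun a : Fin m => name a ∈ X).image name := by
        intro x hx
        obtain ⟨a, rfl⟩ := hsub x hx
        exact Finset.mem_image.2 ⟨a, by simpa using hx, rfl⟩
      have h₁ := (Finset.card_le_card h).trans Finset.card_image_le
      rw [length_nameList] at hcard
      change m ≤ X.card + matchNumber (conflict (votes vote)) (votes vote).1 at hcard
      rw [Fintype.card_fin]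
      omega
    · rw [restrict_isSingleCrossing_iff]
      intro a ha b hb
      exact hX' _ (by simpa using ha) _ (by simpa using hb)

theorem candidatePartition_iff (k : ℕ) : (⟨3, vote⟩ : Election (Fin m)).CandidatePartition k ↔
    (strip (conflict (votes vote)))^[k] (votes vote).1 = [] := by
  classical
  have hmem : ∀ x, x ∈ (votes vote).1 ↔ ∃ a : Fin m, name a = x := fun x => mem_nameList _ _
  rw [strip_iterate_eq_nil_iff k (conflict_trans _)]
  constructor
  · rintro ⟨P, hP, hsc⟩
    choose c hc _ using hP
    have hext : ∀ a, Function.extend name (fun a => (c a : ℕ)) 0 (name a) = c a := fun a =>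
      name_injective.extend_apply _ _ a
    -- The value 0 at strings that name no candidate is irrelevant, as these are not in the list.
    refine ⟨Function.extend name (fun a => (c a : ℕ)) 0, fun x hx => ?_⟩
    obtain ⟨a, rfl⟩ := (hmem x).1 hx
    refine ⟨by rw [hext]; exact (c a).2, fun y hy e => ?_⟩
    obtain ⟨b, rfl⟩ := (hmem y).1 hy
    rw [hext, hext] at e
    have e : c a = c b := Fin.ext e
    exact (restrict_isSingleCrossing_iff vote _).1 (hsc (c a)) a (hc a) b (e ▸ hc b)
  · rintro ⟨c, hc⟩
    have hc' : ∀ a : Fin m, name a ∈ (votes vote).1 := fun a => (hmem _).2 ⟨a, rfl⟩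
    refine ⟨fun j => Finset.univ.filter fun a => c (name a) = j, fun a => ?_, fun j => ?_⟩
    · refine ⟨⟨c (name a), (hc _ (hc' a)).1⟩, by simp, fun j hj => Fin.ext ?_⟩
      exact (Finset.mem_filter.1 hj).2.symm
    · rw [restrict_isSingleCrossing_iff]
      intro a ha b hb
      simp only [Finset.mem_filter, Finset.mem_univ, true_and] at ha hb
      exact (hc _ (hc' a)).2 _ (hc' b) (ha.trans hb.symm)

end Three

/-! ## Parsing -/

theorem foldr_bits (w : List Bool) (u : Name) (x : List Name) (y : List (List Name)) :
    (((w.map inclusionBoolΓ').map sym).foldr parseStep ((u :: x) :: y)) =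
      ((w ++ u) :: x) :: y := by
  induction w with
  | nil => rfl
  | cons b w ih =>
    rw [List.map_cons, List.map_cons, List.foldr_cons, ih]
    rfl

theorem foldr_name (n : ℕ) (x : List Name) (y : List (List Name)) :
    (((encodingNatΓ'.encode n ++ [Γ'.comma]).map sym).foldr parseStep (x :: y)) =
      (encodeNat n :: x) :: y := by
  rw [List.map_append, List.foldr_append]
  have := foldr_bits (encodeNat n) [] x y
  rw [List.append_nil] at this
  exact this

theorem foldr_encodeNatList (l : List ℕ) (y : List (List Name)) :
    ((encodeNatList l).map sym).foldr parseStep ([] :: y) = [] :: l.map encodeNat :: y := by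
  have h : ∀ l : List ℕ, ((l.flatMap fun a => encodingNatΓ'.encode a ++ [Γ'.comma]).map
      sym).foldr parseStep ([] :: y) = l.map encodeNat :: y := by
    intro l
    induction l with
    | nil => rfl
    | cons a l ih =>
      rw [List.flatMap_cons, List.map_append, List.foldr_append, ih, foldr_name]
      rfl
  rw [encodeNatList, List.map_cons, List.foldr_cons, List.map_append, List.foldr_append]
  have : ([Γ'.ket].map sym).foldr parseStep ([] :: y) = [] :: y := rfl
  rw [this, h]
  rfl

/-- The empty list in front is reserved for names before the first bracket. The list of candidates
that follows it is not needed, since every vote contains all names. -/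
theorem foldr_encodeElection (E : ElectionInput) :
    ((encodeElection E).map sym).foldr parseStep [[]] =
      [] :: ((List.finRange E.1).map Fin.val).map encodeNat ::
        (List.finRange E.2.numVoters).map (nameList E.2) := by
  have h : ∀ l : List (Fin E.2.numVoters), ((l.flatMap fun i =>
      encodeNatList ((E.2.ranking i).map Fin.val)).map sym).foldr parseStep [[]] =
        [] :: l.map (nameList E.2) := by
    intro l
    induction l with
    | nil => rfl
    | cons a l ih =>
      rw [List.flatMap_cons, List.map_append, List.foldr_append, ih, foldr_encodeNatList,
        List.map_cons, nameList, List.map_map]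
      rfl
  rw [encodeElection, List.map_append, List.foldr_append, h, foldr_encodeNatList]

theorem parse_encodeElection (E : ElectionInput) :
    (parse ((encodeElection E).map sym)).tail.tail =
      (List.finRange E.2.numVoters).map (nameList E.2) := by
  rw [parse, foldr_encodeElection]
  rfl

/-- The number `k` stands before all brackets, so its digits become the first name of the first
list. -/
theorem parse_encodeElectionNat (I : ElectionInput × ℕ) :
    (parse ((encodeElectionNat I).map sym)).tail.tail =
      (List.finRange I.1.2.numVoters).map (nameList I.1.2) ∧
    ((parse ((encodeElectionNat I).map sym)).headD []).headD [] = encodeNat I.2 := by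
  have e : encodeElectionNat I = (encodingNatΓ'.encode I.2 ++ [Γ'.comma]) ++ encodeElection I.1 := by
    simp [encodeElectionNat]
  rw [parse, e, List.map_append, List.foldr_append, foldr_encodeElection, foldr_name]
  exact ⟨rfl, rfl⟩

/-! ## The decision procedures -/

/-- The first three of a list of votes. -/
def firstThree (l : List (List Name)) : List Name × List Name × List Name :=
  (l.headD [], l.tail.headD [], l.tail.tail.headD [])

/-- The decision procedure for Candidate Deletion. -/
def decideDeletion (s : List (Bool × Bool × Bool)) : Bool :=
  -- Two tails remove the names outside brackets and the candidates. If two more leave nothing,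
  -- there are at most two votes and the answer is yes.
  bif (parse s).tail.tail.tail.tail.isEmpty then true
  else leBits (matchNumber (conflict (firstThree (parse s).tail.tail))
    (firstThree (parse s).tail.tail).1) (((parse s).headD []).headD [])

/-- The decision procedure for `k`-Candidate Partition. -/
def decidePartition (k : ℕ) (s : List (Bool × Bool × Bool)) : Bool :=
  bif (parse s).tail.tail.tail.tail.isEmpty then true
  else ((strip (conflict (firstThree (parse s).tail.tail)))^[k]
    (firstThree (parse s).tail.tail).1).isEmpty

theorem firstThree_polyTime : PolyTime fun s => firstThree (parse s).tail.tail := by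
  have := parse_polyTime
  unfold firstThree
  fun_prop

theorem decideDeletion_polyTime : PolyTime decideDeletion := by
  have h₁ := parse_polyTime
  have h₂ := firstThree_polyTime
  have h₃ := matchNumber_polyTime h₂ (fst.comp h₂)
  unfold decideDeletion
  fun_prop

theorem decidePartition_polyTime (k : ℕ) : PolyTime (decidePartition k) := by
  have h₁ := parse_polyTime
  have h₂ := firstThree_polyTime
  have h₃ := (strip_iterate_polyTime k).comp (h₂.prodMk (fst.comp h₂))
  unfold decidePartition
  fun_prop

theorem eq_or_le_two (E : ElectionInput) (h : E.2.numVoters ≤ 3) :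
    (((List.finRange E.2.numVoters).map (nameList E.2)).tail.tail.isEmpty = true ∧
      E.2.numVoters ≤ 2) ∨
    ∃ (m : ℕ) (vote : Fin 3 → LinearOrder (Fin m)), E = ⟨m, 3, vote⟩ ∧
      ((List.finRange E.2.numVoters).map (nameList E.2)).tail.tail.isEmpty = false ∧
      firstThree ((List.finRange E.2.numVoters).map (nameList E.2)) = votes vote := by
  obtain ⟨m, n, vote⟩ := E
  have h : n ≤ 3 := h
  interval_cases n
  · exact .inl ⟨rfl, by simp⟩
  · exact .inl ⟨rfl, by simp⟩
  · exact .inl ⟨rfl, by simp⟩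
  · exact .inr ⟨m, vote, rfl, rfl, rfl⟩

theorem decideDeletion_iff (I : ElectionInput × ℕ) (h : I.1.2.numVoters ≤ 3) :
    decideDeletion ((encodeElectionNat I).map sym) = true ↔ I.1.2.CandidateDeletion I.2 := by
  obtain ⟨h₁, h₂⟩ := parse_encodeElectionNat I
  rw [decideDeletion, h₁, h₂]
  obtain ⟨E, k⟩ := I
  rcases eq_or_le_two E h with ⟨h₃, h₄⟩ | ⟨m, vote, rfl, h₃, h₄⟩
  · simp only [h₃, cond_true, true_iff]
    exact ⟨Finset.univ, by simp, isSingleCrossing_of_le_two _ h₄⟩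
  · dsimp only at h₃ h₄ ⊢
    rw [h₃, h₄, cond_false, leBits_iff, bitsVal_encodeNat, candidateDeletion_iff]

theorem decidePartition_iff (k : ℕ) (hk : 1 ≤ k) (E : ElectionInput) (h : E.2.numVoters ≤ 3) :
    decidePartition k ((encodeElection E).map sym) = true ↔ E.2.CandidatePartition k := by
  rw [decidePartition, parse_encodeElection]
  rcases eq_or_le_two E h with ⟨h₃, h₄⟩ | ⟨m, vote, rfl, h₃, h₄⟩
  · simp only [h₃, cond_true, true_iff]
    -- With `1 ≤ k` there is a class that can take all candidates.
    refine ⟨fun j => if j = ⟨0, hk⟩ then Finset.univ else ∅, fun a => ⟨⟨0, hk⟩, by simp, ?_⟩,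
      fun j => isSingleCrossing_of_le_two _ h₄⟩
    intro j hj
    by_contra hne
    simp [hne] at hj
  · dsimp only at h₃ h₄ ⊢
    rw [h₃, h₄, cond_false, List.isEmpty_iff, candidatePartition_iff]

end StackProg

theorem mainTheorem6 :
    DecidableInPolyTime
        (fun I : {I : ElectionInput × ℕ // I.1.2.numVoters ≤ 3} => encodeElectionNat I.1)
        (fun I => I.1.1.2.CandidateDeletion I.1.2) ∧
      ∀ k : ℕ, 1 ≤ k →
        DecidableInPolyTime
          (fun E : {E : ElectionInput // E.2.numVoters ≤ 3} => encodeElection E.1)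
          (fun E => E.1.2.CandidatePartition k) :=
  ⟨StackProg.decidableInPolyTime_of_polyTime StackProg.decideDeletion_polyTime
      fun I => StackProg.decideDeletion_iff I.1 I.2,
    fun k hk => StackProg.decidableInPolyTime_of_polyTime (StackProg.decidePartition_polyTime k)
      fun E => StackProg.decidePartition_iff k hk E.1 E.2⟩
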